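/- **Setting.** Let $d\ge 1$ and let $A_*\in\mathbb{R}^{d\times d}$ be diagonalizable over $\mathbb{C}$, $A_*=SDS^{-1}$ with $S\in\mathbb{C}^{d\times d}$ invertible and $D$ diagonal, with spectral radius $\rho(A_*)\le 1$. Let $\underline{\rho}$ be the smallest modulus of an eigenvalue of $A_*$, let $\mathrm{cond}(S)=\sqrt{\lambda_{\max}(S^*S)/\lambda_{\min}(S^*S)}$, and let $\Gamma_t=\sum_{s=0}^{t-1}A_*^s(A_*^s)^\top$. Consider $X_0=0$, $X_{t+1}=A_*X_t+\eta_t$ with $\eta_0,\eta_1,\dots$ i.i.d. $\mathcal N(0,\sigma^2I_d)$, $\sigma>0$, and let $\widehat A$ be any least-squares estimator, i.e. any minimizer of $A\mapsto\sum_{t=1}^T\frac12\|X_{t+1}-AX_t\|_2^2$ over $\mathbb{R}^{d\times d}$. For $\delta\in(0,1/2)$ write $L=d\log\!\big(d\,\mathrm{cond}(S)/\delta\big)$. **Statement.** For every $c_0>0$ there are constants $c,C>0$, depending only on $c_0$, such that for all $d\ge1$, $T\in\mathbb{N}$, $\delta\in(0,1/2)$ and all $A_*=SDS^{-1}$ as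 above: 1. Every integer $k\ge 1$ with $T/k\ge c\,L$ is an admissible block length: $$\frac Tk\ \ge\ c_0\Big(d\log\frac d\delta+\log\det(\Gamma_T\Gamma_k^{-1})\Big),$$ and the corresponding least-squares guarantee holds: $$\Pr\Big[\|\widehat A-A_*\|_{\mathrm{op}}>\frac{C}{\sqrt{T\lambda_{\min}(\Gamma_k)}}\sqrt{d\log\frac d\delta+\log\det(\Gamma_T\Gamma_k^{-1})}\,\Big]\le\delta.$$ 2. If $T\ge c\,L$ and $K=\lfloor T/(c\,L)\rfloor$, then with probability at least $1-\delta$ $$\|\widehat A-A_*\|_{\mathrm{op}}\ \le\ C\sqrt{\frac{L}{T\,\lambda_{\min}(\Gamma_K)}}\ \le\ C\sqrt{\frac{L}{T\big(1+\mathrm{cond}(S)^{-2}\sum_{s=1}^{K-1}\underline{\rho}^{2s}\big)}}.$$ -/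

import Mathlib

open MeasureTheory ProbabilityTheory

noncomputable section

namespace LDS

/-- Smallest eigenvalue of a Hermitian matrix (all its eigenvalues are real). -/
def lambdaMin {𝕜 : Type*} [RCLike 𝕜] {d : ℕ} (M : Matrix (Fin d) (Fin d) 𝕜) : ℝ :=
  sInf (spectrum ℝ M)

/-- Largest eigenvalue of a Hermitian matrix (all its eigenvalues are real). -/
def lambdaMax {𝕜 : Type*} [RCLike 𝕜] {d : ℕ} (M : Matrix (Fin d) (Fin d) 𝕜) : ℝ :=
  sSup (spectrum ℝ M)

/-- Complex condition number `√(λ_max(S* S) / λ_min(S* S))`. -/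
def condNumber {d : ℕ} (S : Matrix (Fin d) (Fin d) ℂ) : ℝ :=
  Real.sqrt (lambdaMax (S.conjTranspose * S) / lambdaMin (S.conjTranspose * S))

/-- A real matrix regarded as a complex one. -/
def toComplex {d : ℕ} (A : Matrix (Fin d) (Fin d) ℝ) : Matrix (Fin d) (Fin d) ℂ :=
  A.map (fun x : ℝ => (x : ℂ))

/-- Smallest modulus of a (complex) eigenvalue of a real matrix. -/
def minEigModulus {d : ℕ} (A : Matrix (Fin d) (Fin d) ℝ) : ℝ :=
  sInf ((fun z : ℂ => ‖z‖) '' spectrum ℂ (toComplex A))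

/-- Finite-time controllability Gramian `Γ_t = ∑_{s=0}^{t-1} A^s (A^s)ᵀ`. -/
def gramian {d : ℕ} (A : Matrix (Fin d) (Fin d) ℝ) (t : ℕ) : Matrix (Fin d) (Fin d) ℝ :=
  ∑ s ∈ Finset.range t, A ^ s * (A ^ s).transpose

/-- The action of a matrix on Euclidean space. -/
def act {d : ℕ} (A : Matrix (Fin d) (Fin d) ℝ) :
    EuclideanSpace ℝ (Fin d) →L[ℝ] EuclideanSpace ℝ (Fin d) :=
  Matrix.toEuclideanCLM (n := Fin d) (𝕜 := ℝ) A

/-- Operator norm of a matrix with respect to the Euclidean norm. -/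
def opNorm {d : ℕ} (A : Matrix (Fin d) (Fin d) ℝ) : ℝ := ‖act A‖

/-- The trajectory `X_0 = 0`, `X_{t+1} = A X_t + η_t`. -/
def state {d : ℕ} (A : Matrix (Fin d) (Fin d) ℝ) (η : ℕ → EuclideanSpace ℝ (Fin d)) :
    ℕ → EuclideanSpace ℝ (Fin d)
  | 0 => 0
  | t + 1 => act A (state A η t) + η t

/-- Least-squares loss `∑_{t=1}^T ½ ‖X_{t+1} - B X_t‖²`. -/
def olsLoss {d : ℕ} (X : ℕ → EuclideanSpace ℝ (Fin d)) (T : ℕ)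
    (B : Matrix (Fin d) (Fin d) ℝ) : ℝ :=
  ∑ t ∈ Finset.Icc 1 T, (1 / 2 : ℝ) * ‖X (t + 1) - act B (X t)‖ ^ 2

/-- `B` is an ordinary-least-squares estimate from the trajectory `X_1, …, X_{T+1}`. -/
def IsOLS {d : ℕ} (X : ℕ → EuclideanSpace ℝ (Fin d)) (T : ℕ)
    (B : Matrix (Fin d) (Fin d) ℝ) : Prop :=
  ∀ B' : Matrix (Fin d) (Fin d) ℝ, olsLoss X T B ≤ olsLoss X T B'

/-- `A = S diag(v) S⁻¹` over the complex numbers, with `S` invertible. -/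
def IsDiagonalization {d : ℕ} (A : Matrix (Fin d) (Fin d) ℝ)
    (S : Matrix (Fin d) (Fin d) ℂ) (v : Fin d → ℂ) : Prop :=
  IsUnit S.det ∧ toComplex A = S * Matrix.diagonal v * S⁻¹

/-- The variables `η_0, η_1, …` are i.i.d. with law `N(0, σ² I_d)`. -/
def IsGaussianNoise {Ω : Type*} [MeasurableSpace Ω] (μ : Measure Ω) {d : ℕ} (σ : ℝ)
    (η : ℕ → Ω → EuclideanSpace ℝ (Fin d)) : Prop :=
  iIndepFun η μ ∧
    ∀ t, HasLaw (η t)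
      (multivariateGaussian 0 (σ ^ 2 • (1 : Matrix (Fin d) (Fin d) ℝ))) μ

/-- The complexity term `d log(d/δ) + log det(Γ_T Γ_k⁻¹)`. -/
def complexity {d : ℕ} (A : Matrix (Fin d) (Fin d) ℝ) (δ : ℝ) (T k : ℕ) : ℝ :=
  d * Real.log (d / δ) + Real.log (gramian A T * (gramian A k)⁻¹).det

/-- The term `d log(d cond(S)/δ)`. -/
def diagComplexity {d : ℕ} (S : Matrix (Fin d) (Fin d) ℂ) (δ : ℝ) : ℝ :=
  d * Real.log (d * condNumber S / δ)

end LDS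

end

/-! Write `Y` for the sum of `X_t X_tᵀ` over `t ≤ T`, `V = (Tσ²/16) Γ_k`, and `N_w` for the sum of
`⟪w, η_t⟫ X_t`. For unit `w` and `u = (Â - A)ᵀ w`, comparing the loss at `Â` with the loss at `Â - w
uᵀ` gives `⟪u, Y u⟫ ≤ 2 ⟪u, N_w⟫`; invertibility of `Y` plays no role. Cauchy–Schwarz in the metric
`V + Y` then bounds the error, provided that `Y` dominates a multiple of `Tσ² Γ_k` and that `⟪N_w,
(V + Y)⁻¹ N_w⟫` is small for every unit `w` (`IsOLS.opNorm_sub_le`). Three events of probability at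
most `δ/3` can spoil this.

The determinant of `V + Y` may be large. Since `E ⟪X_t, Γ_T⁻¹ X_t⟫ ≤ σ² d`, Markov's inequality
gives `Y ≤ ρ Γ_T` with `ρ` of order `Tσ² d/δ` (`measure_det_large_le`).

Some direction may be poorly excited. For fixed `x`, the later half of a block of length `2k`
contributes conditionally Gaussian terms of variance at least `σ² ⟪x, Γ_k x⟫`, so `E exp(-c ⟪x, Y
x⟫)` decays geometrically in the number of blocks. Uniformity over directions comes from integrating
in `x` instead of using a net: a bad direction brings with it an ellipsoid of nearly bad ones, whose
volume is bounded below by the determinant control (`measure_empCov_small_le`).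

The noise term may be large. The Gaussian mixture of exponential martingales has mean one, and
integrating it over `w` in the unit ball gives uniformity by the same volume principle
(`measure_noiseSum_large_le`).

For `A = S D S⁻¹` the coordinates of `S* x` turn `‖(A^s)ᵀ x‖²` into a weighted sum of `|v_i|^(2s)`,
up to the extreme eigenvalues of `S* S`. As `|v_i| ≤ 1`, this gives `Γ_T ≤ cond(S)² ⌈T/k⌉ Γ_k`, so
the log determinant costs at most `d (2 log cond(S) + log (2T/k))`. The term in `T/k` is absorbed by
`T/k ≥ c L`; the same coordinates bound `λ_min(Γ_K)` from below. -/

namespace LDS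

/-! ### Quadratic forms -/

/-- The quadratic form `x ↦ ⟪x, G x⟫` of a real matrix. -/
noncomputable def quadForm {d : ℕ} (G : Matrix (Fin d) (Fin d) ℝ)
    (x : EuclideanSpace ℝ (Fin d)) : ℝ :=
  inner ℝ x (act G x)

section QuadForm

variable {d : ℕ} (G H : Matrix (Fin d) (Fin d) ℝ) (x y : EuclideanSpace ℝ (Fin d))

theorem act_mul : act (G * H) x = act G (act H x) := by
  simp [act, map_mul]

theorem act_add_matrix : act (G + H) x = act G x + act H x := by
  simp [act, map_add]

theorem act_sub_matrix : act (G - H) x = act G x - act H x := by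
  simp [act, map_sub]

theorem act_one : act (1 : Matrix (Fin d) (Fin d) ℝ) x = x := by
  simp [act, map_one]

theorem act_smul_matrix (c : ℝ) : act (c • G) x = c • act G x := by
  simp [act, map_smul]

theorem act_sum_matrix {ι : Type*} (s : Finset ι) (F : ι → Matrix (Fin d) (Fin d) ℝ) :
    act (∑ i ∈ s, F i) x = ∑ i ∈ s, act (F i) x := by
  simp [act, map_sum]

theorem act_vecMulVec (a b : EuclideanSpace ℝ (Fin d)) :
    act (Matrix.vecMulVec a b) x = (inner ℝ b x : ℝ) • a := by
  ext i
  simp [act, Matrix.vecMulVec_mulVec, PiLp.inner_apply, dotProduct, mul_comm]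

theorem inner_act : inner ℝ x (act G y) = inner ℝ (act G.transpose x) y := by
  rw [real_inner_comm y]
  simp only [act, Matrix.inner_toEuclideanCLM]
  rw [Matrix.mulVec_transpose, dotProduct_comm y.ofLp, Matrix.dotProduct_mulVec]

theorem quadForm_add_matrix : quadForm (G + H) x = quadForm G x + quadForm H x := by
  simp [quadForm, act_add_matrix, inner_add_right]

theorem quadForm_smul_matrix (c : ℝ) : quadForm (c • G) x = c * quadForm G x := by
  simp [quadForm, act_smul_matrix, inner_smul_right]

theorem quadForm_sum_matrix {ι : Type*} (s : Finset ι) (F : ι → Matrix (Fin d) (Fin d) ℝ) :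
    quadForm (∑ i ∈ s, F i) x = ∑ i ∈ s, quadForm (F i) x := by
  simp [quadForm, act_sum_matrix, inner_sum]

theorem quadForm_smul (c : ℝ) : quadForm G (c • x) = c ^ 2 * quadForm G x := by
  simp [quadForm, inner_smul_left, inner_smul_right]; ring

theorem quadForm_vecMulVec_self (a : EuclideanSpace ℝ (Fin d)) :
    quadForm (Matrix.vecMulVec a a) x = inner ℝ x a ^ 2 := by
  rw [quadForm, act_vecMulVec, inner_smul_right, real_inner_comm]; ring

theorem quadForm_mul_transpose : quadForm (G * G.transpose) x = ‖act G.transpose x‖ ^ 2 := by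
  rw [quadForm, act_mul, inner_act, real_inner_self_eq_norm_sq]

theorem quadForm_transpose_mul : quadForm (G.transpose * G) x = ‖act G x‖ ^ 2 := by
  simpa using quadForm_mul_transpose G.transpose x

theorem continuous_quadForm : Continuous (quadForm G) := by
  unfold quadForm; fun_prop

variable {G H}

theorem quadForm_nonneg (hG : G.PosSemidef) : 0 ≤ quadForm G x := by
  have := hG.dotProduct_mulVec_nonneg x.ofLp
  simpa [quadForm, act, Matrix.inner_toEuclideanCLM] using this

theorem posSemidef_exists_transpose_mul (hG : G.PosSemidef) :
    ∃ B : Matrix (Fin d) (Fin d) ℝ, G = B.transpose * B := by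
  open scoped MatrixOrder in
  obtain ⟨B, hB⟩ := CStarAlgebra.nonneg_iff_eq_star_mul_self.1 hG.nonneg
  exact ⟨B, by simpa [Matrix.star_eq_conjTranspose] using hB⟩

theorem quadForm_eq_norm_sq {B : Matrix (Fin d) (Fin d) ℝ} (hB : G = B.transpose * B)
    (x : EuclideanSpace ℝ (Fin d)) : quadForm G x = ‖act B x‖ ^ 2 := by
  rw [hB, quadForm_transpose_mul]

theorem sqrt_quadForm_add_le (hG : G.PosSemidef) :
    √(quadForm G (x + y)) ≤ √(quadForm G x) + √(quadForm G y) := by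
  obtain ⟨B, hB⟩ := posSemidef_exists_transpose_mul hG
  simp only [quadForm_eq_norm_sq hB, Real.sqrt_sq (norm_nonneg _), map_add]
  exact norm_add_le _ _

theorem quadForm_add_le (hG : G.PosSemidef) :
    quadForm G (x + y) ≤ 2 * quadForm G x + 2 * quadForm G y := by
  obtain ⟨B, hB⟩ := posSemidef_exists_transpose_mul hG
  simp only [quadForm_eq_norm_sq hB, map_add]
  have := norm_add_le (act B x) (act B y)
  have := norm_nonneg (act B x + act B y)
  nlinarith [sq_nonneg (‖act B x‖ - ‖act B y‖)]

/-- Cauchy–Schwarz for the pair of dual norms given by a positive definite matrix. -/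
theorem inner_sq_le_quadForm_mul (hG : G.PosDef) :
    inner ℝ x y ^ 2 ≤ quadForm G x * quadForm G⁻¹ y := by
  obtain ⟨B, hB⟩ := posSemidef_exists_transpose_mul hG.posSemidef
  have hdet : IsUnit B.det := by
    have := hG.det_pos
    rw [hB, Matrix.det_mul, Matrix.det_transpose] at this
    exact isUnit_iff_ne_zero.2 fun h => by simp [h] at this
  have hinv : G⁻¹ = B⁻¹ * B⁻¹.transpose := by
    rw [hB, Matrix.mul_inv_rev, Matrix.transpose_nonsing_inv]
  rw [quadForm_eq_norm_sq hB, hinv, quadForm_mul_transpose]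
  have h : inner ℝ x y = inner ℝ (act B x) (act B⁻¹.transpose y) := by
    rw [inner_act, Matrix.transpose_transpose, ← act_mul, Matrix.nonsing_inv_mul _ hdet, act_one]
  rw [h, ← mul_pow]
  exact sq_le_sq' (by linarith [neg_le_of_abs_le (abs_real_inner_le_norm (act B x)
    (act B⁻¹.transpose y))]) (real_inner_le_norm _ _)

/-- The sublevel sets of a positive definite quadratic form are ellipsoids. -/
theorem volume_quadForm_le (hG : G.PosDef) {r : ℝ} (hr : 0 ≤ r) :
    volume {x | quadForm G x ≤ r ^ 2} =
      ENNReal.ofReal (r ^ d / √G.det) *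
        volume (Metric.closedBall (0 : EuclideanSpace ℝ (Fin d)) 1) := by
  obtain ⟨B, hB⟩ := posSemidef_exists_transpose_mul hG.posSemidef
  have hdet : G.det = B.det ^ 2 := by
    rw [hB, Matrix.det_mul, Matrix.det_transpose, sq]
  have hB0 : B.det ≠ 0 := fun h => by simpa [hdet, h] using hG.det_pos
  have hlin : LinearMap.det (act B).toLinearMap = B.det := by
    rw [act, Matrix.coe_toEuclideanCLM_eq_toEuclideanLin]
    change LinearMap.det (Matrix.toLpLin 2 2 B) = _
    rw [Matrix.toLpLin_eq_toLin, LinearMap.det_toLin]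
  have hset : {x | quadForm G x ≤ r ^ 2} =
      (act B).toLinearMap ⁻¹' Metric.closedBall 0 r := by
    ext x
    simp [quadForm_eq_norm_sq hB, sq_le_sq₀ (norm_nonneg _) hr]
  rw [hset, Measure.addHaar_preimage_linearMap _ (by rwa [hlin]), hlin,
    Measure.addHaar_closedBall' _ _ hr, hdet, Real.sqrt_sq_eq_abs, ← mul_assoc,
    ← ENNReal.ofReal_mul (abs_nonneg _)]
  simp [abs_inv, div_eq_inv_mul]

/-- The larger form has the smaller unit ellipsoid, and the volume of that ellipsoid is proportional
to `det^(-1/2)`. -/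
theorem det_le_det_of_quadForm_le (hG : G.PosDef) (hH : H.PosDef)
    (h : ∀ x, quadForm G x ≤ quadForm H x) : G.det ≤ H.det := by
  have hsub : {x | quadForm H x ≤ 1 ^ 2} ⊆ {x | quadForm G x ≤ 1 ^ 2} :=
    fun x hx => (h x).trans hx
  have hv := measure_mono (μ := volume) hsub
  rw [volume_quadForm_le hG zero_le_one, volume_quadForm_le hH zero_le_one] at hv
  have h0 : volume (Metric.closedBall (0 : EuclideanSpace ℝ (Fin d)) 1) ≠ 0 :=
    (Metric.measure_closedBall_pos _ _ one_pos).ne'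
  have h1 : volume (Metric.closedBall (0 : EuclideanSpace ℝ (Fin d)) 1) ≠ ⊤ :=
    measure_closedBall_lt_top.ne
  rw [ENNReal.mul_le_mul_iff_left h0 h1, ENNReal.ofReal_le_ofReal_iff (by positivity),
    one_pow, one_div_le_one_div (Real.sqrt_pos.2 hH.det_pos) (Real.sqrt_pos.2 hG.det_pos),
    Real.sqrt_le_sqrt_iff hH.det_pos.le] at hv
  exact hv

end QuadForm

/-! ### Monotonicity and positivity of the Gramians -/

section Gramian

variable {d : ℕ} (A : Matrix (Fin d) (Fin d) ℝ)

theorem quadForm_gramian (t : ℕ) (x : EuclideanSpace ℝ (Fin d)) :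
    quadForm (gramian A t) x = ∑ s ∈ Finset.range t, ‖act (A ^ s).transpose x‖ ^ 2 := by
  rw [gramian, quadForm_sum_matrix]
  exact Finset.sum_congr rfl fun s _ => quadForm_mul_transpose _ _

theorem quadForm_gramian_succ (t : ℕ) (x : EuclideanSpace ℝ (Fin d)) :
    quadForm (gramian A (t + 1)) x =
      quadForm (gramian A t) (act A.transpose x) + ‖x‖ ^ 2 := by
  rw [quadForm_gramian, Finset.sum_range_succ', quadForm_gramian]
  simp [act_one, ← act_mul, ← pow_succ]

theorem quadForm_gramian_mono {s t : ℕ} (h : s ≤ t) (x : EuclideanSpace ℝ (Fin d)) :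
    quadForm (gramian A s) x ≤ quadForm (gramian A t) x := by
  rw [quadForm_gramian, quadForm_gramian]
  exact Finset.sum_le_sum_of_subset_of_nonneg (Finset.range_mono h) fun _ _ _ => by positivity

theorem posSemidef_gramian (t : ℕ) : (gramian A t).PosSemidef := by
  refine Matrix.posSemidef_sum _ fun s _ => ?_
  simpa using Matrix.posSemidef_self_mul_conjTranspose (A ^ s)

theorem posDef_gramian {t : ℕ} (ht : 0 < t) : (gramian A t).PosDef := by
  obtain ⟨t, rfl⟩ := Nat.exists_eq_succ_of_ne_zero ht.ne'
  rw [gramian, Finset.sum_range_succ', add_comm]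
  refine Matrix.PosDef.add_posSemidef (by simpa using Matrix.PosDef.one) ?_
  refine Matrix.posSemidef_sum _ fun s _ => ?_
  simpa using Matrix.posSemidef_self_mul_conjTranspose (A ^ (s + 1))

theorem norm_sq_le_quadForm_gramian {t : ℕ} (ht : 0 < t) (x : EuclideanSpace ℝ (Fin d)) :
    ‖x‖ ^ 2 ≤ quadForm (gramian A t) x := by
  have := quadForm_gramian_mono A (Nat.succ_le_of_lt ht) x
  simpa [quadForm_gramian, act_one] using this

theorem det_gramian_mul_inv (T k : ℕ) :
    (gramian A T * (gramian A k)⁻¹).det = (gramian A T).det / (gramian A k).det := by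
  rw [Matrix.det_mul, Matrix.det_nonsing_inv, Ring.inverse_eq_inv', div_eq_mul_inv]

theorem one_le_det_gramian_mul_inv {T k : ℕ} (hk : 0 < k) (hkT : k ≤ T) :
    1 ≤ (gramian A T * (gramian A k)⁻¹).det := by
  rw [det_gramian_mul_inv, one_le_div (posDef_gramian A hk).det_pos]
  exact det_le_det_of_quadForm_le (posDef_gramian A hk) (posDef_gramian A (hk.trans_le hkT))
    (quadForm_gramian_mono A hkT)

end Gramian

/-! ### Extreme eigenvalues -/

section Eigenvalues

variable {𝕜 : Type*} [RCLike 𝕜] {d : ℕ} {M : Matrix (Fin d) (Fin d) 𝕜}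

theorem finite_spectrum_of_isHermitian (hM : M.IsHermitian) : (spectrum ℝ M).Finite := by
  rw [hM.spectrum_real_eq_range_eigenvalues]; exact Set.finite_range _

theorem nonempty_spectrum_of_isHermitian (hd : 0 < d) (hM : M.IsHermitian) :
    (spectrum ℝ M).Nonempty := by
  have : Nonempty (Fin d) := ⟨⟨0, hd⟩⟩
  rw [hM.spectrum_real_eq_range_eigenvalues]; exact Set.range_nonempty _

open Matrix in
theorem inner_toEuclideanLin_eq_sum (hM : M.IsHermitian) (x : EuclideanSpace 𝕜 (Fin d)) :
    RCLike.re (inner 𝕜 x (Matrix.toEuclideanLin M x)) =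
      ∑ i, hM.eigenvalues i * ‖inner 𝕜 (hM.eigenvectorBasis i) x‖ ^ 2 := by
  have hsym := Matrix.isSymmetric_toEuclideanLin_iff.2 hM
  have heig : ∀ i, Matrix.toEuclideanLin M (hM.eigenvectorBasis i) =
      (hM.eigenvalues i : 𝕜) • hM.eigenvectorBasis i := by
    intro i
    ext j
    simpa [RCLike.real_smul_eq_coe_mul] using congrFun (hM.mulVec_eigenvectorBasis i) j
  rw [← hM.eigenvectorBasis.sum_inner_mul_inner, map_sum]
  refine Finset.sum_congr rfl fun i _ => ?_
  rw [← hsym, heig, inner_smul_left, RCLike.conj_ofReal, mul_left_comm, RCLike.re_ofReal_mul,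
    ← inner_conj_symm x, RCLike.conj_mul, ← RCLike.ofReal_pow, RCLike.ofReal_re]

theorem lambdaMin_mul_le (hM : M.IsHermitian) (x : EuclideanSpace 𝕜 (Fin d)) :
    lambdaMin M * ‖x‖ ^ 2 ≤ RCLike.re (inner 𝕜 x (Matrix.toEuclideanLin M x)) := by
  rw [inner_toEuclideanLin_eq_sum hM, ← hM.eigenvectorBasis.sum_sq_norm_inner_right,
    Finset.mul_sum]
  refine Finset.sum_le_sum fun i _ => mul_le_mul_of_nonneg_right ?_ (by positivity)
  exact csInf_le (finite_spectrum_of_isHermitian hM).bddBelow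
    (by rw [hM.spectrum_real_eq_range_eigenvalues]; exact ⟨i, rfl⟩)

theorem le_lambdaMax_mul (hM : M.IsHermitian) (x : EuclideanSpace 𝕜 (Fin d)) :
    RCLike.re (inner 𝕜 x (Matrix.toEuclideanLin M x)) ≤ lambdaMax M * ‖x‖ ^ 2 := by
  rw [inner_toEuclideanLin_eq_sum hM, ← hM.eigenvectorBasis.sum_sq_norm_inner_right,
    Finset.mul_sum]
  refine Finset.sum_le_sum fun i _ => mul_le_mul_of_nonneg_right ?_ (by positivity)
  exact le_csSup (finite_spectrum_of_isHermitian hM).bddAbove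
    (by rw [hM.spectrum_real_eq_range_eigenvalues]; exact ⟨i, rfl⟩)

/-- It suffices to test on eigenvectors. Positivity of `d` matters: over an empty spectrum `sInf`
takes the default value `0`. -/
theorem le_lambdaMin (hd : 0 < d) (hM : M.IsHermitian) {b : ℝ}
    (h : ∀ x : EuclideanSpace 𝕜 (Fin d),
      b * ‖x‖ ^ 2 ≤ RCLike.re (inner 𝕜 x (Matrix.toEuclideanLin M x))) : b ≤ lambdaMin M := by
  refine le_csInf (nonempty_spectrum_of_isHermitian hd hM) fun a ha => ?_
  rw [hM.spectrum_real_eq_range_eigenvalues] at ha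
  obtain ⟨i, rfl⟩ := ha
  have := h (hM.eigenvectorBasis i)
  rw [inner_toEuclideanLin_eq_sum hM, Finset.sum_eq_single i] at this
  · simpa using this
  · intro j _ hj
    simp [hM.eigenvectorBasis.inner_eq_zero hj]
  · simp

theorem lambdaMin_mul_le_quadForm {G : Matrix (Fin d) (Fin d) ℝ} (hG : G.IsHermitian)
    (x : EuclideanSpace ℝ (Fin d)) : lambdaMin G * ‖x‖ ^ 2 ≤ quadForm G x :=
  lambdaMin_mul_le hG x

theorem le_lambdaMin_of_quadForm (hd : 0 < d) {G : Matrix (Fin d) (Fin d) ℝ}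
    (hG : G.IsHermitian) {b : ℝ} (h : ∀ x, b * ‖x‖ ^ 2 ≤ quadForm G x) : b ≤ lambdaMin G :=
  le_lambdaMin hd hG h

theorem one_le_lambdaMin_gramian (hd : 0 < d) (A : Matrix (Fin d) (Fin d) ℝ) {k : ℕ}
    (hk : 0 < k) : 1 ≤ lambdaMin (gramian A k) :=
  le_lambdaMin_of_quadForm hd (posDef_gramian A hk).isHermitian fun x => by
    simpa using norm_sq_le_quadForm_gramian A hk x

end Eigenvalues

/-! ### Gaussian integrals -/

section GaussianIntegrals

open scoped NNReal ENNReal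

/-- Completing the square: with `s = 1 - αv`, the integrand times the density is a constant times
the density of the Gaussian with mean `βv/s` and variance `v/s`. -/
theorem lintegral_exp_quadratic_gaussianReal (v : ℝ≥0) {α : ℝ} (β : ℝ) (h : α * v < 1) :
    ∫⁻ z, ENNReal.ofReal (Real.exp (α * z ^ 2 / 2 + β * z)) ∂gaussianReal 0 v =
      ENNReal.ofReal ((√(1 - α * v))⁻¹ * Real.exp (β ^ 2 * v / (2 * (1 - α * v)))) := by
  rcases eq_or_ne v 0 with rfl | hv
  · simp
  have hs : 0 < 1 - α * v := by linarith
  have hv' : (0 : ℝ) < v := by positivity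
  set s : ℝ≥0 := ⟨1 - α * v, hs.le⟩ with hs_def
  have hsv : (s : ℝ) = 1 - α * v := rfl
  have hs0 : s ≠ 0 := fun h0 => hs.ne' (by rw [← hsv, h0]; rfl)
  have hvs : v / s ≠ 0 := div_ne_zero hv hs0
  have key : ∀ z, gaussianPDF 0 v z * ENNReal.ofReal (Real.exp (α * z ^ 2 / 2 + β * z)) =
      ENNReal.ofReal ((√(1 - α * v))⁻¹ * Real.exp (β ^ 2 * v / (2 * (1 - α * v)))) *
        gaussianPDF (β * v / s) (v / s) z := by
    intro z
    simp only [gaussianPDF, gaussianPDFReal]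
    rw [← ENNReal.ofReal_mul (by positivity), ← ENNReal.ofReal_mul (by positivity)]
    congr 1
    rw [mul_assoc, ← Real.exp_add, mul_mul_mul_comm, ← Real.exp_add, NNReal.coe_div, hsv,
      ← mul_inv, ← Real.sqrt_mul hs.le]
    have hne : 1 - α * v ≠ 0 := hs.ne'
    have hsqrt : 2 * Real.pi * v = (1 - α * v) * (2 * Real.pi * (v / (1 - α * v))) := by
      rw [mul_left_comm, mul_div_cancel₀ _ hne]
    have hexp : -(z - 0) ^ 2 / (2 * (v : ℝ)) + (α * z ^ 2 / 2 + β * z) =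
        β ^ 2 * v / (2 * (1 - α * v)) +
          -(z - β * v / (1 - α * v)) ^ 2 / (2 * (v / (1 - α * v))) := by
      have hv0 : (v : ℝ) ≠ 0 := hv'.ne'
      generalize hr : 1 - α * (v : ℝ) = r at hne ⊢
      obtain rfl : α = (1 - r) / v := by
        rw [← hr]
        field_simp
        ring
      field_simp
      ring
    rw [← hsqrt, hexp]
  rw [gaussianReal_of_var_ne_zero _ hv, lintegral_withDensity_eq_lintegral_mul _
    (measurable_gaussianPDF _ _) (by fun_prop)]
  simp only [Pi.mul_apply, key]
  rw [lintegral_const_mul _ (measurable_gaussianPDF _ _), lintegral_gaussianPDF_eq_one _ hvs,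
    mul_one]

theorem lintegral_exp_neg_sq_gaussianReal (v : ℝ≥0) {c : ℝ} (hc : 0 ≤ c) (a : ℝ) :
    ∫⁻ z, ENNReal.ofReal (Real.exp (-(c * (a + z) ^ 2))) ∂gaussianReal 0 v =
      ENNReal.ofReal ((√(1 + 2 * c * v))⁻¹ * Real.exp (-(c / (1 + 2 * c * v) * a ^ 2))) := by
  have hv : (0 : ℝ) ≤ v := v.2
  have hpos : 0 < 1 + 2 * c * v := by positivity
  have h1 : ∀ z, ENNReal.ofReal (Real.exp (-(c * (a + z) ^ 2))) =
      ENNReal.ofReal (Real.exp (-(c * a ^ 2))) *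
        ENNReal.ofReal (Real.exp (-(2 * c) * z ^ 2 / 2 + -(2 * c * a) * z)) := by
    intro z
    rw [← ENNReal.ofReal_mul (Real.exp_pos _).le, ← Real.exp_add]
    ring_nf
  simp only [h1]
  rw [lintegral_const_mul _ (by fun_prop), lintegral_exp_quadratic_gaussianReal _ _
    (by nlinarith), ← ENNReal.ofReal_mul (Real.exp_pos _).le, mul_left_comm, ← Real.exp_add]
  have h2 : 1 - -(2 * c) * v = 1 + 2 * c * v := by ring
  rw [h2]
  congr 3
  field_simp
  ring

theorem lintegral_sq_gaussianReal (v : ℝ≥0) (a : ℝ) :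
    ∫⁻ z, ENNReal.ofReal ((a + z) ^ 2) ∂gaussianReal 0 v = ENNReal.ofReal (a ^ 2 + v) := by
  have hL : MemLp (fun z : ℝ => z) 2 (gaussianReal 0 v) := memLp_id_gaussianReal 2
  have h1 : Integrable (fun z : ℝ => z) (gaussianReal 0 v) := hL.integrable one_le_two
  have h2 : Integrable (fun z : ℝ => z ^ 2) (gaussianReal 0 v) := hL.integrable_sq
  have hvar : ∫ z, z ^ 2 ∂gaussianReal 0 v = v := by
    have := variance_id_gaussianReal (μ := 0) (v := v)
    rw [variance_eq_integral measurable_id.aemeasurable] at this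
    simpa using this
  have hexp : (fun z : ℝ => (a + z) ^ 2) = fun z => (a ^ 2 + 2 * a * z) + z ^ 2 := by
    ext z; ring
  have hi1 : Integrable (fun z : ℝ => a ^ 2 + 2 * a * z) (gaussianReal 0 v) :=
    (integrable_const _).add (h1.const_mul _)
  rw [← ofReal_integral_eq_lintegral_ofReal (by rw [hexp]; exact hi1.add h2)
    (ae_of_all _ fun z => sq_nonneg _), hexp, integral_add hi1 h2,
    integral_add (integrable_const _) (h1.const_mul _), integral_const_mul, hvar]
  simp

end GaussianIntegrals

/-! ### Conditioning on the past -/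

section Noise

open scoped NNReal ENNReal

variable {Ω : Type*} [MeasurableSpace Ω] {μ : Measure Ω} {d : ℕ}
  {σ : ℝ} {η : ℕ → Ω → EuclideanSpace ℝ (Fin d)}

/-- Both laws have the same characteristic function, the one on the left being evaluated at `u • w`.
-/
theorem map_inner_multivariateGaussian (σ : ℝ) (w : EuclideanSpace ℝ (Fin d)) :
    (multivariateGaussian 0 (σ ^ 2 • (1 : Matrix (Fin d) (Fin d) ℝ))).map (fun y => inner ℝ w y) =
      gaussianReal 0 (σ ^ 2 * ‖w‖ ^ 2).toNNReal := by
  have hS : (σ ^ 2 • (1 : Matrix (Fin d) (Fin d) ℝ)).PosSemidef :=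
    Matrix.PosSemidef.one.smul (sq_nonneg σ)
  have : IsProbabilityMeasure ((multivariateGaussian 0
      (σ ^ 2 • (1 : Matrix (Fin d) (Fin d) ℝ))).map (fun y => inner ℝ w y)) :=
    Measure.isProbabilityMeasure_map (by fun_prop)
  refine Measure.ext_of_charFun ?_
  ext u
  rw [charFun_gaussianReal, charFun_apply,
    integral_map (by fun_prop) (by fun_prop)]
  have h := charFun_multivariateGaussian (μ := 0) hS (u • w)
  rw [charFun_apply] at h
  simp only [inner_smul_right, real_inner_comm w] at h ⊢
  simp only [RCLike.inner_apply, conj_trivial]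
  rw [h]
  have hw : w.ofLp ⬝ᵥ w.ofLp = ‖w‖ ^ 2 := by
    rw [EuclideanSpace.real_norm_sq_eq]; simp [dotProduct, sq]
  rw [Real.coe_toNNReal _ (by positivity)]
  congr 1
  simp [Matrix.smul_mulVec, hw]
  ring

theorem IsGaussianNoise.aemeasurable (hη : IsGaussianNoise μ σ η) (t : ℕ) :
    AEMeasurable (η t) μ := (hη.2 t).aemeasurable

theorem IsGaussianNoise.aemeasurable_path (hη : IsGaussianNoise μ σ η) :
    AEMeasurable (fun ω i => η i ω) μ := aemeasurable_pi_lambda _ hη.aemeasurable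

theorem IsGaussianNoise.indepFun_past (hη : IsGaussianNoise μ σ η) (t : ℕ) :
    IndepFun (fun ω i => if i < t then η i ω else 0) (η t) μ := by
  have h := iIndepFun.indepFun_finset₀ (Finset.range t) {t} (by simp) hη.1 hη.aemeasurable
  let φ : ((i : Finset.range t) → EuclideanSpace ℝ (Fin d)) → ℕ → EuclideanSpace ℝ (Fin d) :=
    fun e i => if hi : i ∈ Finset.range t then e ⟨i, hi⟩ else 0
  have hφ : Measurable φ := by
    refine measurable_pi_lambda _ fun i => ?_
    by_cases hi : i ∈ Finset.range t
    · simp only [φ, hi, dif_pos]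
      exact measurable_pi_apply (⟨i, hi⟩ : Finset.range t)
    · simp only [φ, hi]
      exact measurable_const
  have h2 : IndepFun (fun ω => φ fun i => η i ω) (η t) μ :=
    h.comp hφ (measurable_pi_apply (⟨t, by simp⟩ : ({t} : Finset ℕ)))
  convert h2 using 3
  simp [φ]

/-- Integrating out `η_t` in a functional of `η_0, …, η_{t-1}` and `⟪w, η_t⟫`. -/
theorem IsGaussianNoise.lintegral_step [IsProbabilityMeasure μ]
    (hη : IsGaussianNoise μ σ η) (t : ℕ)
    (w : EuclideanSpace ℝ (Fin d)) (F : (ℕ → EuclideanSpace ℝ (Fin d)) → ℝ → ℝ≥0∞)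
    (hF : Measurable (Function.uncurry F)) (hdep : DependsOn F (Set.Iio t)) :
    ∫⁻ ω, F (fun i => η i ω) (inner ℝ w (η t ω)) ∂μ =
      ∫⁻ ω, ∫⁻ z, F (fun i => η i ω) z ∂gaussianReal 0 (σ ^ 2 * ‖w‖ ^ 2).toNNReal ∂μ := by
  -- Erasing the noise from time `t` on leaves `F` unchanged and makes its path argument independent
  -- of `η t`, so the joint law is a product and Tonelli applies.
  set P : Ω → ℕ → EuclideanSpace ℝ (Fin d) := fun ω i => if i < t then η i ω else 0 with hP
  have hPm : AEMeasurable P μ := by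
    refine aemeasurable_pi_lambda _ fun i => ?_
    by_cases hi : i < t
    · simpa [P, hi] using hη.aemeasurable i
    · simp [P, hi]
  have hFP : ∀ ω, F (fun i => η i ω) = F (P ω) := fun ω => hdep fun i hi => by
    simp only [Set.mem_Iio] at hi
    simp [P, hi]
  have hind : IndepFun P (fun ω => inner ℝ w (η t ω)) μ :=
    (hη.indepFun_past t).comp measurable_id (by fun_prop : Measurable fun y => inner ℝ w y)
  have hZ : AEMeasurable (fun ω => inner ℝ w (η t ω)) μ :=
    (by fun_prop : Measurable fun y => inner ℝ w y).comp_aemeasurable (hη.aemeasurable t)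
  have hlaw : μ.map (fun ω => inner ℝ w (η t ω)) =
      gaussianReal 0 (σ ^ 2 * ‖w‖ ^ 2).toNNReal := by
    rw [← map_inner_multivariateGaussian, ← (hη.2 t).map_eq,
      AEMeasurable.map_map_of_aemeasurable (by fun_prop) (hη.aemeasurable t)]
    rfl
  simp only [hFP]
  have hprod := (indepFun_iff_map_prod_eq_prod_map_map hPm hZ).1 hind
  calc ∫⁻ ω, F (P ω) (inner ℝ w (η t ω)) ∂μ
      = ∫⁻ p, Function.uncurry F p ∂(μ.map fun ω => (P ω, inner ℝ w (η t ω))) := by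
        rw [lintegral_map' hF.aemeasurable (hPm.prodMk hZ)]; rfl
    _ = ∫⁻ e, ∫⁻ z, F e z ∂gaussianReal 0 (σ ^ 2 * ‖w‖ ^ 2).toNNReal ∂(μ.map P) := by
        rw [hprod, hlaw, lintegral_prod _ hF.aemeasurable]; rfl
    _ = _ := lintegral_map' hF.lintegral_prod_right'.aemeasurable hPm

end Noise

/-! ### The trajectory as a function of the noise path -/

section State

variable {d : ℕ} (A : Matrix (Fin d) (Fin d) ℝ)

/-- The noise is only a.e. measurable, so random quantities are handled as continuous functions of
the noise path, composed with the path map. `DependsOn` plays the role of adaptedness to a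
filtration. -/
theorem continuous_state (t : ℕ) : Continuous fun e => state A e t := by
  induction t with
  | zero => exact continuous_const
  | succ t ih => simp only [state]; fun_prop

theorem dependsOn_state {s t : ℕ} (hst : s ≤ t) :
    DependsOn (fun e => state A e s) (Set.Iio t) := by
  intro e e' h
  induction s with
  | zero => rfl
  | succ s ih =>
    have h1 := ih (by omega)
    have h2 : e s = e' s := h s (by simp; omega)
    simp only [state] at h1 ⊢
    rw [h1, h2]

theorem inner_state_succ (e : ℕ → EuclideanSpace ℝ (Fin d)) (t : ℕ)
    (x : EuclideanSpace ℝ (Fin d)) :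
    inner ℝ x (state A e (t + 1)) =
      inner ℝ (act A.transpose x) (state A e t) + inner ℝ x (e t) := by
  rw [state, inner_add_right, inner_act]

end State

/-! ### The empirical covariance and its lower tail -/

/-- The empirical second moment matrix `∑_{t<n} X_t X_tᵀ`. -/
noncomputable def empCov {d : ℕ} (A : Matrix (Fin d) (Fin d) ℝ)
    (e : ℕ → EuclideanSpace ℝ (Fin d)) (n : ℕ) : Matrix (Fin d) (Fin d) ℝ :=
  ∑ t ∈ Finset.range n, Matrix.vecMulVec (state A e t) (state A e t)

section EmpCov

variable {d : ℕ} (A : Matrix (Fin d) (Fin d) ℝ)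

theorem quadForm_empCov (e : ℕ → EuclideanSpace ℝ (Fin d)) (n : ℕ)
    (x : EuclideanSpace ℝ (Fin d)) :
    quadForm (empCov A e n) x = ∑ t ∈ Finset.range n, inner ℝ x (state A e t) ^ 2 := by
  rw [empCov, quadForm_sum_matrix]
  exact Finset.sum_congr rfl fun t _ => quadForm_vecMulVec_self _ _

theorem posSemidef_empCov (e : ℕ → EuclideanSpace ℝ (Fin d)) (n : ℕ) :
    (empCov A e n).PosSemidef :=
  Matrix.posSemidef_sum _ fun t _ => by
    simpa using Matrix.posSemidef_vecMulVec_self_star (state A e t).ofLp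

theorem dependsOn_empCov (n : ℕ) : DependsOn (fun e => empCov A e n) (Set.Iio n) := by
  intro e e' h
  refine Finset.sum_congr rfl fun t ht => ?_
  have := dependsOn_state A (Finset.mem_range.1 ht).le h
  simp only at this
  rw [this]

theorem continuous_empCov (n : ℕ) : Continuous fun e => empCov A e n := by
  refine continuous_finsetSum _ fun t _ => ?_
  have := continuous_state A t
  refine Continuous.matrix_vecMulVec ?_ ?_ <;> fun_prop

theorem continuous_quadForm_empCov (n : ℕ) :
    Continuous fun p : (ℕ → EuclideanSpace ℝ (Fin d)) × EuclideanSpace ℝ (Fin d) =>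
      quadForm (empCov A p.1 n) p.2 := by
  simp only [quadForm_empCov]
  have := continuous_state A
  fun_prop

theorem quadForm_empCov_mono (e : ℕ → EuclideanSpace ℝ (Fin d)) {m n : ℕ} (h : m ≤ n)
    (x : EuclideanSpace ℝ (Fin d)) : quadForm (empCov A e m) x ≤ quadForm (empCov A e n) x := by
  rw [quadForm_empCov, quadForm_empCov]
  exact Finset.sum_le_sum_of_subset_of_nonneg (Finset.range_mono h) fun _ _ _ => by positivity

end EmpCov

/-! ### Block small-ball estimates in a fixed direction -/

section SmallBall

open scoped NNReal ENNReal

variable {Ω : Type*} [MeasurableSpace Ω] {μ : Measure Ω} [IsProbabilityMeasure μ] {d : ℕ}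
  {σ : ℝ} {η : ℕ → Ω → EuclideanSpace ℝ (Fin d)}

/-- Conditionally on the first `t` noise vectors, `⟪x, X_{t+j}⟫` is Gaussian with variance
`σ² ⟪x, Γ_j x⟫`, so that the Laplace transform of its square is at most that of the centred
variable. -/
theorem IsGaussianNoise.lintegral_exp_neg_sq_le (hη : IsGaussianNoise μ σ η)
    (A : Matrix (Fin d) (Fin d) ℝ) (t : ℕ) {H : (ℕ → EuclideanSpace ℝ (Fin d)) → ℝ≥0∞}
    (hH : Measurable H) (hdep : DependsOn H (Set.Iio t)) (j : ℕ) :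
    ∀ {c : ℝ}, 0 ≤ c → ∀ x : EuclideanSpace ℝ (Fin d),
      ∫⁻ ω, H (fun i => η i ω) * ENNReal.ofReal
          (Real.exp (-(c * inner ℝ x (state A (fun i => η i ω) (t + j)) ^ 2))) ∂μ ≤
        ENNReal.ofReal (√(1 + 2 * c * (σ ^ 2 * quadForm (gramian A j) x)))⁻¹ *
          ∫⁻ ω, H (fun i => η i ω) ∂μ := by
  induction j with
  | zero =>
    intro c hc x
    simp only [quadForm_gramian, Finset.range_zero, Finset.sum_empty, mul_zero, add_zero,
      Real.sqrt_one, inv_one, ENNReal.ofReal_one, one_mul]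
    refine lintegral_mono fun ω => ?_
    refine mul_le_of_le_one_right' ?_
    rw [ENNReal.ofReal_le_one, Real.exp_le_one_iff]
    have := mul_nonneg hc (sq_nonneg (inner ℝ x (state A (fun i => η i ω) t)))
    linarith
  | succ j ih =>
    intro c hc x
    set v : ℝ≥0 := (σ ^ 2 * ‖x‖ ^ 2).toNNReal with hv_def
    have hv : (v : ℝ) = σ ^ 2 * ‖x‖ ^ 2 := Real.coe_toNNReal _ (by positivity)
    have hpos : 0 < 1 + 2 * c * (v : ℝ) := by positivity
    have hq : 0 ≤ quadForm (gramian A j) (act A.transpose x) :=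
      quadForm_nonneg _ (posSemidef_gramian A j)
    -- The latest noise vector is integrated out first. This replaces `x` by `Aᵀ x` and `c` by `c /
    -- (1 + 2cv)`, hence the induction over all `c` and `x`.
    let F : (ℕ → EuclideanSpace ℝ (Fin d)) → ℝ → ℝ≥0∞ := fun e z => H e *
      ENNReal.ofReal (Real.exp (-(c * (inner ℝ (act A.transpose x) (state A e (t + j)) + z) ^ 2)))
    have hF : Measurable (Function.uncurry F) := by
      refine (hH.comp measurable_fst).mul ?_
      have hs := (continuous_state A (t + j)).measurable
      fun_prop
    have hFdep : DependsOn F (Set.Iio (t + j)) := by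
      intro e e' h
      have h1 := dependsOn_state A le_rfl h
      have h2 : H e = H e' := hdep fun i hi => h i (lt_of_lt_of_le hi (Nat.le_add_right t j))
      simp only at h1
      simp only [F, h1, h2]
    have hstep := hη.lintegral_step (t + j) x F hF hFdep
    have hL : ∀ ω, H (fun i => η i ω) * ENNReal.ofReal
          (Real.exp (-(c * inner ℝ x (state A (fun i => η i ω) (t + (j + 1))) ^ 2))) =
        F (fun i => η i ω) (inner ℝ x (η (t + j) ω)) := by
      intro ω
      simp only [F]
      rw [← add_assoc, inner_state_succ]
    have hR : ∀ ω, ∫⁻ z, F (fun i => η i ω) z ∂gaussianReal 0 v =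
        ENNReal.ofReal (√(1 + 2 * c * v))⁻¹ * (H (fun i => η i ω) * ENNReal.ofReal
          (Real.exp (-(c / (1 + 2 * c * v) *
            inner ℝ (act A.transpose x) (state A (fun i => η i ω) (t + j)) ^ 2)))) := by
      intro ω
      simp only [F]
      rw [lintegral_const_mul _ (by fun_prop), lintegral_exp_neg_sq_gaussianReal _ hc,
        ENNReal.ofReal_mul (by positivity), mul_left_comm]
    simp only [hL, hstep, ← hv_def, hR]
    rw [lintegral_const_mul' _ _ ENNReal.ofReal_ne_top]
    refine (mul_le_mul_right (ih (div_nonneg hc hpos.le) _) _).trans_eq ?_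
    -- The factors telescope: `(1 + 2cv)(1 + 2cσ²q/(1 + 2cv)) = 1 + 2c(v + σ²q)`, where `q` is the
    -- form of `Γ_j` at `Aᵀ x`, and `v + σ²q` is `σ²` times the form of `Γ_(j+1)` at `x`.
    rw [← mul_assoc, ← ENNReal.ofReal_mul (by positivity), ← mul_inv, ← Real.sqrt_mul hpos.le]
    congr 4
    rw [quadForm_gramian_succ, mul_add, mul_add, hv, ← hv]
    field_simp
    ring

/-- Jensen's inequality for `exp`. States inside one block are dependent; this replaces the
exponential of their sum by an average of single-time exponentials. -/
theorem exp_neg_mul_sum_le {k : ℕ} (hk : 0 < k) (c : ℝ) (f : ℕ → ℝ) :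
    Real.exp (-(c * ∑ i ∈ Finset.range k, f i)) ≤
      ∑ i ∈ Finset.range k, (k : ℝ)⁻¹ * Real.exp (-(c * k * f i)) := by
  have hk' : (k : ℝ) ≠ 0 := by positivity
  have := convexOn_exp.map_sum_le (t := Finset.range k) (w := fun _ => (k : ℝ)⁻¹)
    (p := fun i => -(c * k * f i)) (fun _ _ => by positivity) (by simp [hk'])
    (fun _ _ => Set.mem_univ _)
  simp only [smul_eq_mul] at this
  refine le_trans (le_of_eq ?_) this
  congr 1
  rw [Finset.mul_sum, ← Finset.sum_neg_distrib]
  refine Finset.sum_congr rfl fun i _ => ?_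
  field_simp

/-- Exponential lower-tail bound for `∑ ⟪x, X_t⟫²` over `m` blocks of length `2k`. -/
theorem IsGaussianNoise.lintegral_exp_neg_empCov_le (hη : IsGaussianNoise μ σ η)
    (A : Matrix (Fin d) (Fin d) ℝ) {k : ℕ} (hk : 0 < k) {c : ℝ} (hc : 0 ≤ c)
    (x : EuclideanSpace ℝ (Fin d)) (m : ℕ) :
    ∫⁻ ω, ENNReal.ofReal
        (Real.exp (-(c * quadForm (empCov A (fun i => η i ω) (2 * k * m)) x))) ∂μ ≤
      ENNReal.ofReal (√(1 + 2 * (c * k) * (σ ^ 2 * quadForm (gramian A k) x)))⁻¹ ^ m := by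
  have hk' : (0 : ℝ) < k := by positivity
  induction m with
  | zero => simp [quadForm_empCov]
  | succ m ih =>
    set n := 2 * k * m with hn
    let H : (ℕ → EuclideanSpace ℝ (Fin d)) → ℝ≥0∞ := fun e =>
      ENNReal.ofReal (Real.exp (-(c * quadForm (empCov A e n) x)))
    have hH : Measurable H := by
      have h := (continuous_quadForm_empCov A n).comp (Continuous.prodMk_left x)
      have h' : Continuous fun e => quadForm (empCov A e n) x := h
      have := h'.measurable
      fun_prop
    have hHdep : DependsOn H (Set.Iio n) := by
      intro e e' h
      have := dependsOn_empCov A n h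
      simp only at this
      simp only [H, this]
    have hpt : ∀ e : ℕ → EuclideanSpace ℝ (Fin d),
        ENNReal.ofReal (Real.exp (-(c * quadForm (empCov A e (2 * k * (m + 1))) x))) ≤
          ∑ i ∈ Finset.range k, ENNReal.ofReal (k : ℝ)⁻¹ * (H e * ENNReal.ofReal
            (Real.exp (-(c * k * inner ℝ x (state A e (n + (k + i))) ^ 2)))) := by
      intro e
      -- The first `k` states of the new block are discarded, so that each retained state carries at
      -- least `k` fresh noise vectors.
      have hsum : quadForm (empCov A e n) x +
          ∑ i ∈ Finset.range k, inner ℝ x (state A e (n + (k + i))) ^ 2 ≤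
            quadForm (empCov A e (2 * k * (m + 1))) x := by
        have : 2 * k * (m + 1) = n + (k + k) := by rw [hn]; ring
        rw [this, quadForm_empCov, quadForm_empCov, Finset.sum_range_add, Finset.sum_range_add]
        have : 0 ≤ ∑ i ∈ Finset.range k, inner ℝ x (state A e (n + i)) ^ 2 :=
          Finset.sum_nonneg fun _ _ => by positivity
        linarith
      have h1 : Real.exp (-(c * quadForm (empCov A e (2 * k * (m + 1))) x)) ≤
          Real.exp (-(c * quadForm (empCov A e n) x)) *
            ∑ i ∈ Finset.range k, (k : ℝ)⁻¹ *
              Real.exp (-(c * k * inner ℝ x (state A e (n + (k + i))) ^ 2)) := by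
        refine le_trans ?_ (mul_le_mul_of_nonneg_left (exp_neg_mul_sum_le hk c _)
          (Real.exp_pos _).le)
        rw [← Real.exp_add, Real.exp_le_exp]
        nlinarith [mul_le_mul_of_nonneg_left hsum hc]
      refine (ENNReal.ofReal_le_ofReal h1).trans_eq ?_
      rw [Finset.mul_sum, ENNReal.ofReal_sum_of_nonneg fun _ _ => by positivity]
      refine Finset.sum_congr rfl fun i _ => ?_
      rw [mul_left_comm, ENNReal.ofReal_mul (by positivity), ENNReal.ofReal_mul (by positivity)]
    refine (lintegral_mono fun ω => hpt fun i => η i ω).trans ?_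
    have hpath := hη.aemeasurable_path
    rw [lintegral_finsetSum' _ fun i _ => ?_]
    swap
    · have h1 := (continuous_state A (n + (k + i))).measurable
      have h2 : Measurable fun e => ENNReal.ofReal (k : ℝ)⁻¹ * (H e * ENNReal.ofReal
            (Real.exp (-(c * k * inner ℝ x (state A e (n + (k + i))) ^ 2)))) := by fun_prop
      exact h2.comp_aemeasurable hpath
    set R := ENNReal.ofReal (√(1 + 2 * (c * k) * (σ ^ 2 * quadForm (gramian A k) x)))⁻¹ with hR
    have hterm : ∀ i ∈ Finset.range k,
        ∫⁻ ω, ENNReal.ofReal (k : ℝ)⁻¹ * (H (fun i => η i ω) * ENNReal.ofReal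
            (Real.exp (-(c * k * inner ℝ x (state A (fun i => η i ω) (n + (k + i))) ^ 2)))) ∂μ ≤
          ENNReal.ofReal (k : ℝ)⁻¹ * R ^ (m + 1) := by
      intro i _
      rw [lintegral_const_mul' _ _ ENNReal.ofReal_ne_top]
      refine mul_le_mul_right ?_ _
      -- Conditioning at the start of the block gives variance from `Γ_(k+i) ≥ Γ_k`; the remaining
      -- integral of `H` is the induction hypothesis.
      refine (hη.lintegral_exp_neg_sq_le A n hH hHdep (k + i) (by positivity) x).trans ?_
      refine (mul_le_mul' (ENNReal.ofReal_le_ofReal ?_) ih).trans_eq (pow_succ' R m).symm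
      have hmono := quadForm_gramian_mono A (Nat.le_add_right k i) x
      have hnn := quadForm_nonneg x (posSemidef_gramian A k)
      gcongr
    refine (Finset.sum_le_sum hterm).trans_eq ?_
    rw [Finset.sum_const, Finset.card_range, nsmul_eq_mul, ← mul_assoc,
      ← ENNReal.ofReal_natCast, ← ENNReal.ofReal_mul hk'.le, mul_inv_cancel₀ hk'.ne',
      ENNReal.ofReal_one, one_mul]

end SmallBall

/-- The regularizer `(T σ² / 16) Γ_k`. -/
noncomputable def regCov {d : ℕ} (A : Matrix (Fin d) (Fin d) ℝ) (σ : ℝ) (T k : ℕ) :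
    Matrix (Fin d) (Fin d) ℝ :=
  (T * σ ^ 2 / 16 : ℝ) • gramian A k

section RegCov

variable {d : ℕ} (A : Matrix (Fin d) (Fin d) ℝ) {σ : ℝ} {T k : ℕ}

theorem posDef_regCov (hσ : 0 < σ) (hT : 0 < T) (hk : 0 < k) : (regCov A σ T k).PosDef :=
  (posDef_gramian A hk).smul (by positivity)

theorem quadForm_regCov (x : EuclideanSpace ℝ (Fin d)) :
    quadForm (regCov A σ T k) x = T * σ ^ 2 / 16 * quadForm (gramian A k) x :=
  quadForm_smul_matrix _ _ _

theorem det_regCov : (regCov A σ T k).det = (T * σ ^ 2 / 16) ^ d * (gramian A k).det := by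
  rw [regCov, Matrix.det_smul, Fintype.card_fin]

theorem posDef_regCov_add_empCov (hσ : 0 < σ) (hT : 0 < T) (hk : 0 < k)
    (e : ℕ → EuclideanSpace ℝ (Fin d)) (n : ℕ) : (regCov A σ T k + empCov A e n).PosDef :=
  (posDef_regCov A hσ hT hk).add_posSemidef (posSemidef_empCov A e n)

end RegCov

/-! ### Uniform lower tail by a volume argument -/

section LowerTail

open scoped NNReal ENNReal

variable {Ω : Type*} [MeasurableSpace Ω] {μ : Measure Ω} {d : ℕ}
  {σ : ℝ} {η : ℕ → Ω → EuclideanSpace ℝ (Fin d)}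

/-- If some direction is badly excited, then so are all directions in an ellipsoid around it. -/
theorem ellipsoid_subset {G V Y : Matrix (Fin d) (Fin d) ℝ} (hG : G.PosSemidef)
    (hY : Y.PosSemidef) {r : ℝ} (hr : 0 < r) (hV : ∀ x, quadForm V x = 16 * r ^ 2 * quadForm G x)
    {u : EuclideanSpace ℝ (Fin d)} (hu1 : quadForm G u = 1) (hu : quadForm Y u ≤ r ^ 2)
    {x : EuclideanSpace ℝ (Fin d)} (hx : quadForm (V + Y) (x - u) ≤ r ^ 2) :
    9 / 16 ≤ quadForm G x ∧ quadForm G x ≤ (5 / 4) ^ 2 ∧ quadForm Y x ≤ 4 * r ^ 2 := by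
  rw [quadForm_add_matrix, hV] at hx
  have hY0 := quadForm_nonneg (x - u) hY
  have hG0 := quadForm_nonneg (x - u) hG
  have hGx := quadForm_nonneg x hG
  have hh : quadForm G (x - u) ≤ (1 / 4) ^ 2 := by
    by_contra hcon
    push Not at hcon
    have : r ^ 2 < 16 * r ^ 2 * quadForm G (x - u) := by nlinarith [pow_pos hr 2]
    linarith
  -- In the seminorm of `G`, `x` is within `1/4` of the unit vector `u`; this gives the bounds `3/4`
  -- and `5/4`.
  have hs : √(quadForm G (x - u)) ≤ 1 / 4 := by
    rw [← Real.sqrt_sq (show (0 : ℝ) ≤ 1 / 4 by norm_num)]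
    exact Real.sqrt_le_sqrt hh
  have hs' : √(quadForm G (u - x)) ≤ 1 / 4 := by
    have : quadForm G (u - x) = quadForm G (x - u) := by
      rw [← neg_sub, ← neg_one_smul ℝ (x - u), quadForm_smul]; ring
    rwa [this]
  have h1 := sqrt_quadForm_add_le u (x - u) hG
  have h2 := sqrt_quadForm_add_le x (u - x) hG
  rw [add_sub_cancel] at h1 h2
  rw [hu1, Real.sqrt_one] at h1 h2
  have hsq := Real.sq_sqrt hGx
  have h3 : 3 / 4 ≤ √(quadForm G x) := by linarith
  have h4 : √(quadForm G x) ≤ 5 / 4 := by linarith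
  refine ⟨by nlinarith, by nlinarith, ?_⟩
  have h5 := quadForm_add_le u (x - u) hY
  rw [add_sub_cancel] at h5
  have : quadForm Y (x - u) ≤ r ^ 2 := by
    have := mul_nonneg (mul_nonneg (by norm_num : (0 : ℝ) ≤ 16) (sq_nonneg r)) hG0
    linarith
  linarith

theorem IsGaussianNoise.lintegral_exp_neg_empCov_le_exp_neg [IsProbabilityMeasure μ]
    (hη : IsGaussianNoise μ σ η) (hσ : 0 < σ)
    (A : Matrix (Fin d) (Fin d) ℝ) {k n m : ℕ} (hk : 0 < k) (hm : 2 * k * m ≤ n)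
    {x : EuclideanSpace ℝ (Fin d)} (hx : 9 / 16 ≤ quadForm (gramian A k) x) :
    ∫⁻ ω, ENNReal.ofReal
        (Real.exp (-(8 / (k * σ ^ 2) * quadForm (empCov A (fun i => η i ω) n) x))) ∂μ ≤
      ENNReal.ofReal (Real.exp (-m)) := by
  have hk' : (0 : ℝ) < k := by positivity
  have hc : 0 < 8 / (k * σ ^ 2) := by positivity
  -- The rate `8/(kσ²)` is chosen so that each block contributes a factor at most `(1 + 16 ·
  -- 9/16)^(-1/2) = 10^(-1/2)`, which is below `1/e`.
  have h1 : 2 * (8 / (k * σ ^ 2) * k) * (σ ^ 2 * quadForm (gramian A k) x) =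
      16 * quadForm (gramian A k) x := by
    field_simp; norm_num
  have h2 : ENNReal.ofReal
      (√(1 + 2 * (8 / (k * σ ^ 2) * k) * (σ ^ 2 * quadForm (gramian A k) x)))⁻¹ ≤
      ENNReal.ofReal (Real.exp (-1)) := by
    rw [h1, Real.exp_neg]
    refine ENNReal.ofReal_le_ofReal (inv_anti₀ (Real.exp_pos _) (Real.le_sqrt_of_sq_le ?_))
    have he := Real.exp_one_lt_d9
    have he0 := Real.exp_pos 1
    nlinarith
  have h3 : ENNReal.ofReal (Real.exp (-1)) ^ m = ENNReal.ofReal (Real.exp (-m)) := by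
    rw [← ENNReal.ofReal_pow (Real.exp_pos _).le, ← Real.exp_nat_mul]; simp
  rw [← h3]
  refine le_trans (lintegral_mono fun ω => ENNReal.ofReal_le_ofReal (Real.exp_le_exp.2
    (neg_le_neg (mul_le_mul_of_nonneg_left
      (quadForm_empCov_mono A (fun i => η i ω) hm x) hc.le))))
    ((hη.lintegral_exp_neg_empCov_le A hk hc.le x m).trans (pow_le_pow_left' h2 m))

theorem aemeasurable_exp_neg_quadForm_empCov (hη : IsGaussianNoise μ σ η)
    (A : Matrix (Fin d) (Fin d) ℝ) (c : ℝ) (n : ℕ) (ν : Measure (EuclideanSpace ℝ (Fin d))) :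
    AEMeasurable (fun p : Ω × EuclideanSpace ℝ (Fin d) => ENNReal.ofReal
      (Real.exp (-(c * quadForm (empCov A (fun i => η i p.1) n) p.2)))) (μ.prod ν) := by
  have h1 : Measurable fun p : (ℕ → EuclideanSpace ℝ (Fin d)) × EuclideanSpace ℝ (Fin d) =>
      ENNReal.ofReal (Real.exp (-(c * quadForm (empCov A p.1 n) p.2))) := by
    have := (continuous_quadForm_empCov A n).measurable
    fun_prop
  have h2 : AEMeasurable (fun p : Ω × EuclideanSpace ℝ (Fin d) =>
      ((fun i => η i p.1), p.2)) (μ.prod ν) :=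
    AEMeasurable.prodMk (AEMeasurable.comp_fst hη.aemeasurable_path) measurable_snd.aemeasurable
  have h3 := h1.comp_aemeasurable h2
  exact h3

/-- With overwhelming probability the empirical covariance dominates a multiple of `T σ² Γ_k`,
unless its determinant is large. -/
theorem IsGaussianNoise.measure_empCov_small_le [IsProbabilityMeasure μ]
    (hη : IsGaussianNoise μ σ η) (hσ : 0 < σ)
    (A : Matrix (Fin d) (Fin d) ℝ) {k T m : ℕ} (hk : 0 < k) (hT : 0 < T)
    (hm : 2 * k * m ≤ T + 1) {D : ℝ} (hD : 0 < D) :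
    μ {ω | (regCov A σ T k + empCov A (fun i => η i ω) (T + 1)).det ≤
          D * (regCov A σ T k).det ∧
        ∃ u, quadForm (empCov A (fun i => η i ω) (T + 1)) u <
          T * σ ^ 2 / 256 * quadForm (gramian A k) u} ≤
      ENNReal.ofReal (5 ^ d * √D * Real.exp (T / (8 * k) - m)) := by
  have hk' : (0 : ℝ) < k := by positivity
  have hT' : (0 : ℝ) < T := by positivity
  set Γ := gramian A k with hΓ_def
  have hΓ : Γ.PosDef := posDef_gramian A hk
  have hdetΓ : 0 < √Γ.det := Real.sqrt_pos.2 hΓ.det_pos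
  set Y : Ω → Matrix (Fin d) (Fin d) ℝ := fun ω => empCov A (fun i => η i ω) (T + 1) with hY_def
  set c : ℝ := 8 / (k * σ ^ 2) with hc_def
  have hc : 0 < c := by positivity
  -- With this radius `V = 16 r² Γ_k`, and the threshold `Tσ²/256` for bad excitation is `r²`.
  set r : ℝ := √T * σ / 16 with hr_def
  have hr : 0 < r := by positivity
  have hr2 : r ^ 2 = T * σ ^ 2 / 256 := by
    rw [hr_def, div_pow, mul_pow, Real.sq_sqrt hT'.le]; norm_num
  -- A fixed shell containing every ellipsoid that can arise, whatever the bad direction.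
  set B : Set (EuclideanSpace ℝ (Fin d)) :=
    {x | 9 / 16 ≤ quadForm Γ x ∧ quadForm Γ x ≤ (5 / 4) ^ 2} with hB_def
  have hBm : MeasurableSet B :=
    ((isClosed_le continuous_const (continuous_quadForm Γ)).inter
      (isClosed_le (continuous_quadForm Γ) continuous_const)).measurableSet
  set vb := volume (Metric.closedBall (0 : EuclideanSpace ℝ (Fin d)) 1) with hvb
  have hvb0 : vb ≠ 0 := (Metric.measure_closedBall_pos _ _ one_pos).ne'
  have hvb1 : vb ≠ ⊤ := measure_closedBall_lt_top.ne
  have hvolB : volume B ≤ ENNReal.ofReal ((5 / 4) ^ d / √Γ.det) * vb := by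
    rw [← volume_quadForm_le hΓ (by norm_num)]
    exact measure_mono fun x hx => hx.2
  -- Markov's inequality is applied to this integral over directions: its mean is small by the
  -- fixed-direction bound, and one bad direction already makes it large.
  let I : Ω → ℝ≥0∞ := fun ω => ∫⁻ x in B, ENNReal.ofReal (Real.exp (-(c * quadForm (Y ω) x)))
  have hjoint : AEMeasurable (fun p : Ω × EuclideanSpace ℝ (Fin d) =>
      ENNReal.ofReal (Real.exp (-(c * quadForm (Y p.1) p.2)))) (μ.prod (volume.restrict B)) := by
    have h1 := aemeasurable_exp_neg_quadForm_empCov hη A c (T + 1) (volume.restrict B)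
    exact h1
  have hI : AEMeasurable I μ := hjoint.lintegral_prod_right'
  have hEI : ∫⁻ ω, I ω ∂μ ≤
      ENNReal.ofReal (Real.exp (-m)) * (ENNReal.ofReal ((5 / 4) ^ d / √Γ.det) * vb) := by
    rw [lintegral_lintegral_swap hjoint]
    have hpt : ∀ x ∈ B, ∫⁻ ω, ENNReal.ofReal (Real.exp (-(c * quadForm (Y ω) x))) ∂μ ≤
        ENNReal.ofReal (Real.exp (-m)) :=
      fun x hx => hη.lintegral_exp_neg_empCov_le_exp_neg hσ A hk hm hx.1
    refine (setLIntegral_mono' (μ := volume) (s := B)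
      (g := fun _ => ENNReal.ofReal (Real.exp (-m))) hBm hpt).trans ?_
    rw [setLIntegral_const]
    exact mul_le_mul_right hvolB _
  -- The exponential is the least value of the integrand on the bad ellipsoid, as `c · 4r² =
  -- T/(8k)`; the denominator comes from the ellipsoid's volume `r^d / √det(V + Y)` relative to the
  -- unit ball.
  set L : ℝ := Real.exp (-(T / (8 * k))) / (4 ^ d * √D * √Γ.det) with hL_def
  have hLpos : 0 < L := by positivity
  have hsub : {ω | (regCov A σ T k + Y ω).det ≤ D * (regCov A σ T k).det ∧
        ∃ u, quadForm (Y ω) u < T * σ ^ 2 / 256 * quadForm Γ u} ⊆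
      {ω | ENNReal.ofReal L * vb ≤ I ω} := by
    rintro ω ⟨hdet, u, hu⟩
    have hYω : (Y ω).PosSemidef := posSemidef_empCov A _ _
    have hM : (regCov A σ T k + Y ω).PosDef := posDef_regCov_add_empCov A hσ hT hk _ _
    have hqu : 0 < quadForm Γ u := by
      rcases (quadForm_nonneg u hΓ.posSemidef).eq_or_lt with h | h
      · rw [← h, mul_zero] at hu
        exact absurd (quadForm_nonneg u hYω) (not_le.2 hu)
      · exact h
    -- The bad direction is rescaled to lie on the unit `Γ_k`-sphere.
    set s := (√(quadForm Γ u))⁻¹ with hs_def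
    have hs2 : s ^ 2 = (quadForm Γ u)⁻¹ := by rw [hs_def, inv_pow, Real.sq_sqrt hqu.le]
    have hu1 : quadForm Γ (s • u) = 1 := by
      rw [quadForm_smul, hs2, inv_mul_cancel₀ hqu.ne']
    have hu2 : quadForm (Y ω) (s • u) ≤ r ^ 2 := by
      rw [quadForm_smul, hs2, hr2, inv_mul_le_iff₀ hqu, mul_comm]
      exact hu.le
    have hV : ∀ x, quadForm (regCov A σ T k) x = 16 * r ^ 2 * quadForm Γ x := fun x => by
      rw [quadForm_regCov, hr2]; ring
    set Ell := {x | quadForm (regCov A σ T k + Y ω) (x - s • u) ≤ r ^ 2} with hEll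
    have hEllm : MeasurableSet Ell :=
      (isClosed_le ((continuous_quadForm _).comp (continuous_id.sub continuous_const))
        continuous_const).measurableSet
    have hEB : ∀ x ∈ Ell, x ∈ B ∧ quadForm (Y ω) x ≤ 4 * r ^ 2 := fun x hx => by
      obtain ⟨h1, h2, h3⟩ := ellipsoid_subset hΓ.posSemidef hYω hr hV hu1 hu2 hx
      exact ⟨⟨h1, h2⟩, h3⟩
    have hvolE : volume Ell =
        ENNReal.ofReal (r ^ d / √(regCov A σ T k + Y ω).det) * vb := by
      rw [← volume_quadForm_le hM hr.le]
      rw [← measure_preimage_add_right volume (-(s • u))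
        {x | quadForm (regCov A σ T k + Y ω) x ≤ r ^ 2}, hEll]
      simp only [sub_eq_add_neg]
      rfl
    have hdetV : √(D * (regCov A σ T k).det) = 4 ^ d * √D * √Γ.det * r ^ d := by
      have h1 : D * (regCov A σ T k).det = D * Γ.det * ((4 * r) ^ d) ^ 2 := by
        rw [det_regCov, ← pow_mul, mul_comm d 2, pow_mul, mul_pow, hr2]; ring
      rw [h1, Real.sqrt_mul (by have := hΓ.det_pos; positivity), Real.sqrt_sq (by positivity),
        Real.sqrt_mul hD.le, mul_pow]
      ring
    have hdetM : 0 < √(regCov A σ T k + Y ω).det := Real.sqrt_pos.2 hM.det_pos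
    calc ENNReal.ofReal L * vb
        ≤ ENNReal.ofReal (Real.exp (-(T / (8 * k)))) * volume Ell := by
          rw [hvolE, ← mul_assoc, ← ENNReal.ofReal_mul (Real.exp_pos _).le]
          refine mul_le_mul_left (ENNReal.ofReal_le_ofReal ?_) _
          have h2 : √(regCov A σ T k + Y ω).det ≤ 4 ^ d * √D * √Γ.det * r ^ d := by
            rw [← hdetV]; exact Real.sqrt_le_sqrt hdet
          rw [hL_def, div_eq_mul_inv]
          refine mul_le_mul_of_nonneg_left ?_ (Real.exp_pos _).le
          rw [le_div_iff₀ hdetM, inv_mul_le_iff₀ (by positivity)]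
          exact h2
      _ = ∫⁻ x in Ell, ENNReal.ofReal (Real.exp (-(T / (8 * k)))) := by simp
      _ ≤ ∫⁻ x in Ell, ENNReal.ofReal (Real.exp (-(c * quadForm (Y ω) x))) := by
          refine setLIntegral_mono' hEllm fun x hx => ?_
          refine ENNReal.ofReal_le_ofReal (Real.exp_le_exp.2 (neg_le_neg ?_))
          calc c * quadForm (Y ω) x ≤ c * (4 * r ^ 2) :=
                mul_le_mul_of_nonneg_left (hEB x hx).2 hc.le
            _ = T / (8 * k) := by rw [hr2, hc_def]; field_simp; norm_num
      _ ≤ I ω := lintegral_mono_set fun x hx => (hEB x hx).1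
  have hLv0 : ENNReal.ofReal L * vb ≠ 0 :=
    mul_ne_zero (ENNReal.ofReal_pos.2 hLpos).ne' hvb0
  have hLv1 : ENNReal.ofReal L * vb ≠ ⊤ := ENNReal.mul_ne_top ENNReal.ofReal_ne_top hvb1
  refine (measure_mono hsub).trans ?_
  rw [← ENNReal.mul_le_mul_iff_right hLv0 hLv1]
  -- The volume ratio of shell and ellipsoid is at most `(5/4)^d · 4^d √D = 5^d √D`.
  refine (mul_meas_ge_le_lintegral₀ hI _).trans (hEI.trans_eq ?_)
  rw [← mul_assoc, mul_right_comm (ENNReal.ofReal L), ← ENNReal.ofReal_mul (Real.exp_pos _).le,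
    ← ENNReal.ofReal_mul hLpos.le]
  congr 2
  rw [hL_def, sub_eq_add_neg, Real.exp_add, Real.exp_neg (T / (8 * k) : ℝ), div_pow]
  field_simp

end LowerTail

/-! ### Self-normalized sums -/

section RankOne

variable {d : ℕ} {M : Matrix (Fin d) (Fin d) ℝ}

theorem act_inv_act (hM : IsUnit M.det) (x : EuclideanSpace ℝ (Fin d)) :
    act M⁻¹ (act M x) = x := by
  rw [← act_mul, Matrix.nonsing_inv_mul _ hM, act_one]

theorem act_act_inv (hM : IsUnit M.det) (x : EuclideanSpace ℝ (Fin d)) :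
    act M (act M⁻¹ x) = x := by
  rw [← act_mul, Matrix.mul_nonsing_inv _ hM, act_one]

theorem inner_act_inv_comm (hM : M.PosDef) (x y : EuclideanSpace ℝ (Fin d)) :
    inner ℝ x (act M⁻¹ y) = inner ℝ (act M⁻¹ x) y := by
  have h : M⁻¹.transpose = M⁻¹ := by simpa using hM.inv.isHermitian.eq
  rw [inner_act, h]

theorem det_add_vecMulVec_self (hM : M.PosDef) (x : EuclideanSpace ℝ (Fin d)) :
    (M + Matrix.vecMulVec x x).det = M.det * (1 + quadForm M⁻¹ x) := by
  have hu : IsUnit M.det := isUnit_iff_ne_zero.2 hM.det_pos.ne'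
  rw [Matrix.vecMulVec_eq (Fin 1), Matrix.det_add_replicateCol_mul_replicateRow hu]
  congr 1
  simp only [Matrix.det_unique, Matrix.add_apply, Matrix.one_apply_eq]
  rw [quadForm, act,
    Matrix.inner_toEuclideanCLM, Matrix.mul_assoc, ← Matrix.replicateCol_mulVec,
    Matrix.replicateRow_mul_replicateCol_apply]

theorem posDef_add_vecMulVec_self (hM : M.PosDef) (x : EuclideanSpace ℝ (Fin d)) :
    (M + Matrix.vecMulVec x x).PosDef :=
  hM.add_posSemidef (by simpa using Matrix.posSemidef_vecMulVec_self_star x.ofLp)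

/-- The Sherman–Morrison formula. -/
theorem act_inv_add_vecMulVec_self (hM : M.PosDef) (x y : EuclideanSpace ℝ (Fin d)) :
    act (M + Matrix.vecMulVec x x)⁻¹ y =
      act M⁻¹ y - (inner ℝ x (act M⁻¹ y) / (1 + quadForm M⁻¹ x)) • act M⁻¹ x := by
  have hu : IsUnit M.det := isUnit_iff_ne_zero.2 hM.det_pos.ne'
  have hu' : IsUnit (M + Matrix.vecMulVec x x).det :=
    isUnit_iff_ne_zero.2 (posDef_add_vecMulVec_self hM x).det_pos.ne'
  have ha : 1 + quadForm M⁻¹ x ≠ 0 :=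
    (add_pos_of_pos_of_nonneg one_pos (quadForm_nonneg x hM.inv.posSemidef)).ne'
  set z := act M⁻¹ y - (inner ℝ x (act M⁻¹ y) / (1 + quadForm M⁻¹ x)) • act M⁻¹ x with hz
  have hy : act (M + Matrix.vecMulVec x x) z = y := by
    rw [act_add_matrix, act_vecMulVec, hz, map_sub, map_smul, act_act_inv hu, act_act_inv hu,
      inner_sub_right, inner_smul_right, ← quadForm, sub_add, ← sub_smul]
    have : inner ℝ x (act M⁻¹ y) / (1 + quadForm M⁻¹ x) - (inner ℝ x (act M⁻¹ y) -
        inner ℝ x (act M⁻¹ y) / (1 + quadForm M⁻¹ x) * quadForm M⁻¹ x) = 0 := by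
      field_simp
      ring
    rw [this, zero_smul, sub_zero]
  conv_lhs => rw [← hy]
  exact act_inv_act hu' z

/-- By Sherman–Morrison, adding one sample changes the self-normalized form by a quadratic
polynomial in the new noise coordinate, so its exponential can be integrated explicitly. -/
theorem quadForm_inv_add_vecMulVec_self (hM : M.PosDef) (x S : EuclideanSpace ℝ (Fin d)) (z : ℝ) :
    quadForm (M + Matrix.vecMulVec x x)⁻¹ (S + z • x) = quadForm M⁻¹ S +
      (2 * inner ℝ x (act M⁻¹ S) * z + quadForm M⁻¹ x * z ^ 2 - inner ℝ x (act M⁻¹ S) ^ 2) /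
        (1 + quadForm M⁻¹ x) := by
  have ha : 1 + quadForm M⁻¹ x ≠ 0 :=
    (add_pos_of_pos_of_nonneg one_pos (quadForm_nonneg x hM.inv.posSemidef)).ne'
  have hsym : inner ℝ S (act M⁻¹ x) = inner ℝ x (act M⁻¹ S) := by
    rw [inner_act_inv_comm hM, real_inner_comm]
  have hxx : inner ℝ x (act M⁻¹ x) = quadForm M⁻¹ x := rfl
  have hSS : inner ℝ S (act M⁻¹ S) = quadForm M⁻¹ S := rfl
  rw [quadForm, act_inv_add_vecMulVec_self hM]
  simp only [map_add, map_smul, inner_add_left, inner_add_right, inner_sub_right,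
    inner_smul_left, inner_smul_right, hsym, hxx, hSS, conj_trivial]
  field_simp
  ring

end RankOne

section Continuity

variable {X : Type*} [TopologicalSpace X] {d : ℕ}

theorem continuous_act_apply {G : X → Matrix (Fin d) (Fin d) ℝ}
    {x : X → EuclideanSpace ℝ (Fin d)} (hG : Continuous G) (hx : Continuous x) :
    Continuous fun a => act (G a) (x a) := by
  have h : Continuous fun a => (G a).mulVec (x a).ofLp := by fun_prop
  exact (PiLp.continuous_toLp 2 _).comp h

theorem continuous_inv_of_posDef {G : X → Matrix (Fin d) (Fin d) ℝ} (hG : Continuous G)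
    (hpos : ∀ a, (G a).PosDef) : Continuous fun a => (G a)⁻¹ := by
  refine continuous_iff_continuousAt.2 fun a => ?_
  refine (continuousAt_matrix_inv (G a) ?_).comp hG.continuousAt
  exact NormedRing.inverse_continuousAt (Units.mk0 _ (hpos a).det_pos.ne')

end Continuity

/-- The sum `∑_{t<n} ⟪w, η_t⟫ X_t`. -/
noncomputable def noiseSum {d : ℕ} (A : Matrix (Fin d) (Fin d) ℝ)
    (e : ℕ → EuclideanSpace ℝ (Fin d)) (n : ℕ) (w : EuclideanSpace ℝ (Fin d)) :
    EuclideanSpace ℝ (Fin d) :=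
  ∑ t ∈ Finset.range n, (inner ℝ w (e t) : ℝ) • state A e t

section NoiseSum

variable {d : ℕ} (A : Matrix (Fin d) (Fin d) ℝ)

theorem noiseSum_add (e : ℕ → EuclideanSpace ℝ (Fin d)) (n : ℕ)
    (w w' : EuclideanSpace ℝ (Fin d)) :
    noiseSum A e n (w + w') = noiseSum A e n w + noiseSum A e n w' := by
  simp [noiseSum, inner_add_left, add_smul, Finset.sum_add_distrib]

theorem noiseSum_smul (e : ℕ → EuclideanSpace ℝ (Fin d)) (n : ℕ)
    (w : EuclideanSpace ℝ (Fin d)) (c : ℝ) :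
    noiseSum A e n (c • w) = c • noiseSum A e n w := by
  simp [noiseSum, inner_smul_left, Finset.smul_sum, mul_smul]

theorem inner_noiseSum (e : ℕ → EuclideanSpace ℝ (Fin d)) (n : ℕ)
    (w u : EuclideanSpace ℝ (Fin d)) :
    inner ℝ u (noiseSum A e n w) =
      ∑ t ∈ Finset.range n, inner ℝ w (e t) * inner ℝ u (state A e t) := by
  simp [noiseSum, inner_sum, inner_smul_right]

theorem dependsOn_noiseSum (n : ℕ) (w : EuclideanSpace ℝ (Fin d)) :
    DependsOn (fun e => noiseSum A e n w) (Set.Iio n) := by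
  intro e e' h
  refine Finset.sum_congr rfl fun t ht => ?_
  have h1 := dependsOn_state A (Finset.mem_range.1 ht).le h
  have h2 : e t = e' t := h t (Finset.mem_range.1 ht)
  simp only at h1
  rw [h1, h2]

theorem continuous_noiseSum (n : ℕ) :
    Continuous fun p : (ℕ → EuclideanSpace ℝ (Fin d)) × EuclideanSpace ℝ (Fin d) =>
      noiseSum A p.1 n p.2 := by
  have := continuous_state A
  unfold noiseSum
  fun_prop

end NoiseSum

/-! ### The method of mixtures in a fixed direction -/

section SelfNormalized

open scoped NNReal ENNReal

variable {Ω : Type*} [MeasurableSpace Ω] {μ : Measure Ω} {d : ℕ}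
  {σ : ℝ} {η : ℕ → Ω → EuclideanSpace ℝ (Fin d)}

/-- The method-of-mixtures martingale for the direction `w`. -/
noncomputable def mixtureWeight (A V : Matrix (Fin d) (Fin d) ℝ) (σ : ℝ) (n : ℕ)
    (e : ℕ → EuclideanSpace ℝ (Fin d)) (w : EuclideanSpace ℝ (Fin d)) : ℝ :=
  Real.exp (quadForm (V + empCov A e n)⁻¹ (noiseSum A e n w) / (2 * σ ^ 2)) *
    √(V.det / (V + empCov A e n).det)

theorem continuous_mixtureWeight (A : Matrix (Fin d) (Fin d) ℝ) {V : Matrix (Fin d) (Fin d) ℝ}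
    (hV : V.PosDef) (σ : ℝ) (n : ℕ) :
    Continuous fun p : (ℕ → EuclideanSpace ℝ (Fin d)) × EuclideanSpace ℝ (Fin d) =>
      mixtureWeight A V σ n p.1 p.2 := by
  have hpos : ∀ e, (V + empCov A e n).PosDef := fun e =>
    hV.add_posSemidef (posSemidef_empCov A e n)
  have hcov := continuous_empCov A n
  have hM : Continuous fun p : (ℕ → EuclideanSpace ℝ (Fin d)) × EuclideanSpace ℝ (Fin d) =>
      V + empCov A p.1 n := by fun_prop
  have h1 := continuous_inv_of_posDef hM fun p => hpos p.1
  have h2 := continuous_act_apply h1 (continuous_noiseSum A n)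
  have h3 := (continuous_noiseSum A n).inner (𝕜 := ℝ) h2
  have h4 : Continuous fun p : (ℕ → EuclideanSpace ℝ (Fin d)) × EuclideanSpace ℝ (Fin d) =>
      V.det / (V + empCov A p.1 n).det :=
    continuous_const.div hM.matrix_det fun p => (hpos p.1).det_pos.ne'
  exact (h3.div_const _).rexp.mul h4.sqrt

theorem mixtureWeight_succ (A : Matrix (Fin d) (Fin d) ℝ) {V : Matrix (Fin d) (Fin d) ℝ}
    (hV : V.PosDef) (hσ : 0 < σ) (n : ℕ) (w : EuclideanSpace ℝ (Fin d))
    (e : ℕ → EuclideanSpace ℝ (Fin d)) {N : Matrix (Fin d) (Fin d) ℝ}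
    (hN : N = (V + empCov A e n)⁻¹) {x : EuclideanSpace ℝ (Fin d)} (hx : x = state A e n)
    {b : ℝ} (hb : b = inner ℝ x (act N (noiseSum A e n w))) :
    mixtureWeight A V σ (n + 1) e w =
      mixtureWeight A V σ n e w * ((√(1 + quadForm N x))⁻¹ *
        Real.exp (-(b ^ 2 / (2 * σ ^ 2 * (1 + quadForm N x)))) *
        Real.exp (quadForm N x / ((1 + quadForm N x) * σ ^ 2) * inner ℝ w (e n) ^ 2 / 2 +
          b / ((1 + quadForm N x) * σ ^ 2) * inner ℝ w (e n))) := by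
  have hM : (V + empCov A e n).PosDef := hV.add_posSemidef (posSemidef_empCov A e n)
  have ha : 0 < 1 + quadForm N x :=
    add_pos_of_pos_of_nonneg one_pos (quadForm_nonneg x (hN ▸ hM.inv.posSemidef))
  have h1 : empCov A e (n + 1) = empCov A e n + Matrix.vecMulVec x x := by
    rw [hx]; exact Finset.sum_range_succ _ _
  have h2 : noiseSum A e (n + 1) w = noiseSum A e n w + (inner ℝ w (e n) : ℝ) • x := by
    rw [hx]; exact Finset.sum_range_succ _ _
  rw [mixtureWeight, h1, h2, ← add_assoc, quadForm_inv_add_vecMulVec_self hM,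
    det_add_vecMulVec_self hM, ← div_div V.det,
    Real.sqrt_div (div_nonneg hV.det_pos.le hM.det_pos.le),
    mixtureWeight, mul_assoc _⁻¹, ← Real.exp_add, div_eq_mul_inv (√_), ← hN, ← hb]
  have hexp : (quadForm N (noiseSum A e n w) + (2 * b * inner ℝ w (e n) +
      quadForm N x * inner ℝ w (e n) ^ 2 - b ^ 2) / (1 + quadForm N x)) / (2 * σ ^ 2) =
      quadForm N (noiseSum A e n w) / (2 * σ ^ 2) +
      (-(b ^ 2 / (2 * σ ^ 2 * (1 + quadForm N x))) +
        (quadForm N x / ((1 + quadForm N x) * σ ^ 2) * inner ℝ w (e n) ^ 2 / 2 +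
          b / ((1 + quadForm N x) * σ ^ 2) * inner ℝ w (e n))) := by
    field_simp
    ring
  rw [hexp, Real.exp_add]
  ring

/-- The weight is the average of `exp((⟪l, N_w⟫ - ⟪l, Y l⟫/2)/σ²)` over `l ∼ N(0, σ² V⁻¹)`. Its
martingale property is checked directly: the rank-one updates of inverse and determinant produce
exactly the factor that the Gaussian integral over the new noise cancels. -/
theorem IsGaussianNoise.lintegral_mixtureWeight [IsProbabilityMeasure μ]
    (hη : IsGaussianNoise μ σ η) (hσ : 0 < σ) (A : Matrix (Fin d) (Fin d) ℝ)
    {V : Matrix (Fin d) (Fin d) ℝ} (hV : V.PosDef) {w : EuclideanSpace ℝ (Fin d)}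
    (hw : ‖w‖ = 1) (n : ℕ) :
    ∫⁻ ω, ENNReal.ofReal (mixtureWeight A V σ n (fun i => η i ω) w) ∂μ = 1 := by
  induction n with
  | zero =>
    have : V.det / V.det = 1 := div_self hV.det_pos.ne'
    simp [mixtureWeight, empCov, noiseSum, quadForm, this]
  | succ n ih =>
    set v : ℝ≥0 := (σ ^ 2 * ‖w‖ ^ 2).toNNReal with hv_def
    have hv : (v : ℝ) = σ ^ 2 := by
      rw [hv_def, Real.coe_toNNReal _ (by positivity), hw]; ring
    let N : (ℕ → EuclideanSpace ℝ (Fin d)) → Matrix (Fin d) (Fin d) ℝ :=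
      fun e => (V + empCov A e n)⁻¹
    let a : (ℕ → EuclideanSpace ℝ (Fin d)) → ℝ := fun e => quadForm (N e) (state A e n)
    let b : (ℕ → EuclideanSpace ℝ (Fin d)) → ℝ := fun e =>
      inner ℝ (state A e n) (act (N e) (noiseSum A e n w))
    let g : (ℕ → EuclideanSpace ℝ (Fin d)) → ℝ := fun e => mixtureWeight A V σ n e w *
      ((√(1 + a e))⁻¹ * Real.exp (-(b e ^ 2 / (2 * σ ^ 2 * (1 + a e)))))
    let F : (ℕ → EuclideanSpace ℝ (Fin d)) → ℝ → ℝ≥0∞ := fun e z =>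
      ENNReal.ofReal (g e) * ENNReal.ofReal (Real.exp (a e / ((1 + a e) * σ ^ 2) * z ^ 2 / 2 +
        b e / ((1 + a e) * σ ^ 2) * z))
    have hpos : ∀ e, (V + empCov A e n).PosDef := fun e =>
      hV.add_posSemidef (posSemidef_empCov A e n)
    have ha0 : ∀ e, 0 ≤ a e := fun e => quadForm_nonneg _ (hpos e).inv.posSemidef
    have hcN : Continuous N :=
      continuous_inv_of_posDef (continuous_const.add (continuous_empCov A n)) hpos
    have hcx := continuous_state A n
    have hcS : Continuous fun e => noiseSum A e n w := by
      have h := (continuous_noiseSum A n).comp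
        (continuous_id.prodMk (continuous_const (y := w)))
      exact h
    have hca : Continuous a := hcx.inner (continuous_act_apply hcN hcx)
    have hcb : Continuous b := hcx.inner (continuous_act_apply hcN hcS)
    have hcm : Continuous fun e => mixtureWeight A V σ n e w := by
      have h := (continuous_mixtureWeight A hV σ n).comp
        (continuous_id.prodMk (continuous_const (y := w)))
      exact h
    have hF : Measurable (Function.uncurry F) := by
      have h1 := hca.measurable
      have h2 := hcb.measurable
      have h3 := hcm.measurable
      have h4 : Measurable g := by fun_prop
      fun_prop
    have hdep : DependsOn F (Set.Iio n) := by
      intro e e' h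
      have h1 := dependsOn_state A le_rfl h
      have h2 := dependsOn_empCov A n h
      have h3 := dependsOn_noiseSum A n w h
      simp only at h1 h2 h3
      simp only [F, g, a, b, N, mixtureWeight, h1, h2, h3]
    have hL : ∀ ω, ENNReal.ofReal (mixtureWeight A V σ (n + 1) (fun i => η i ω) w) =
        F (fun i => η i ω) (inner ℝ w (η n ω)) := by
      intro ω
      have hg0 : 0 ≤ g fun i => η i ω := by
        have := ha0 fun i => η i ω
        simp only [g, mixtureWeight]
        positivity
      rw [mixtureWeight_succ A hV hσ n w _ rfl rfl rfl]
      simp only [F]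
      rw [← ENNReal.ofReal_mul hg0]
      simp only [g, a, b, N]
      ring_nf
    have hR : ∀ e, ∫⁻ z, F e z ∂gaussianReal 0 v = ENNReal.ofReal (mixtureWeight A V σ n e w) := by
      intro e
      have h1 : 0 < 1 + a e := add_pos_of_pos_of_nonneg one_pos (ha0 e)
      -- This ratio is below `1`, so the Gaussian integral converges; it equals `√(1 + a)` times the
      -- exponential of `b²/(2σ²(1 + a))`, the inverse of the prefactor in `g`.
      have h2 : a e / ((1 + a e) * σ ^ 2) * v = a e / (1 + a e) := by
        rw [hv]; field_simp
      have h3 : 1 - a e / (1 + a e) = (1 + a e)⁻¹ := by field_simp; ring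
      have hm0 : 0 ≤ mixtureWeight A V σ n e w := by unfold mixtureWeight; positivity
      simp only [F]
      rw [lintegral_const_mul _ (by fun_prop), lintegral_exp_quadratic_gaussianReal _ _ (by
        rw [h2, div_lt_one h1]; linarith), h2, h3, ← ENNReal.ofReal_mul (by positivity)]
      congr 1
      have h4 : (b e / ((1 + a e) * σ ^ 2)) ^ 2 * (v : ℝ) / (2 * (1 + a e)⁻¹) =
          b e ^ 2 / (2 * σ ^ 2 * (1 + a e)) := by
        rw [hv]; field_simp
      rw [h4, Real.sqrt_inv, inv_inv]
      simp only [g]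
      have h5 : √(1 + a e) ≠ 0 := (Real.sqrt_pos.2 h1).ne'
      rw [mul_assoc, mul_mul_mul_comm, ← Real.exp_add, neg_add_cancel, Real.exp_zero, mul_one,
        inv_mul_cancel₀ h5, mul_one]
    simp only [hL]
    rw [hη.lintegral_step n w F hF hdep]
    simp only [← hv_def, hR, ih]

end SelfNormalized

/-! ### From one direction to all directions -/

section SelfNormalizedTail

open scoped NNReal ENNReal

variable {Ω : Type*} [MeasurableSpace Ω] {μ : Measure Ω} {d : ℕ}
  {σ : ℝ} {η : ℕ → Ω → EuclideanSpace ℝ (Fin d)}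

theorem det_div_det_add_empCov_le_one (A : Matrix (Fin d) (Fin d) ℝ)
    {V : Matrix (Fin d) (Fin d) ℝ} (hV : V.PosDef) (e : ℕ → EuclideanSpace ℝ (Fin d)) (n : ℕ) :
    V.det / (V + empCov A e n).det ≤ 1 := by
  have hM := hV.add_posSemidef (posSemidef_empCov A e n)
  rw [div_le_one hM.det_pos]
  refine det_le_det_of_quadForm_le hV hM fun x => ?_
  rw [quadForm_add_matrix]
  linarith [quadForm_nonneg x (posSemidef_empCov A e n)]

/-- The exponent is quadratic in `w`, so shrinking a unit vector only lowers the weight. The whole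
unit ball can then serve as the domain of integration. -/
theorem IsGaussianNoise.lintegral_mixtureWeight_le_one [IsProbabilityMeasure μ]
    (hη : IsGaussianNoise μ σ η) (hσ : 0 < σ) (A : Matrix (Fin d) (Fin d) ℝ)
    {V : Matrix (Fin d) (Fin d) ℝ} (hV : V.PosDef) {w : EuclideanSpace ℝ (Fin d)}
    (hw : ‖w‖ ≤ 1) (n : ℕ) :
    ∫⁻ ω, ENNReal.ofReal (mixtureWeight A V σ n (fun i => η i ω) w) ∂μ ≤ 1 := by
  rcases eq_or_ne w 0 with rfl | hw0
  · have h : ∀ e, mixtureWeight A V σ n e 0 ≤ 1 := by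
      intro e
      have h0 : noiseSum A e n 0 = 0 := by simp [noiseSum]
      rw [mixtureWeight, h0]
      simpa [quadForm] using det_div_det_add_empCov_le_one A hV e n
    calc _ ≤ ∫⁻ _, 1 ∂μ := lintegral_mono fun ω => by
          simpa using ENNReal.ofReal_le_ofReal (h fun i => η i ω)
      _ = 1 := by simp
  · have hn : 0 < ‖w‖ := norm_pos_iff.2 hw0
    set w' := ‖w‖⁻¹ • w with hw'
    have hw1 : ‖w'‖ = 1 := by rw [hw', norm_smul, norm_inv, norm_norm, inv_mul_cancel₀ hn.ne']
    have hww : w = ‖w‖ • w' := by rw [hw', smul_smul, mul_inv_cancel₀ hn.ne', one_smul]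
    rw [← hη.lintegral_mixtureWeight hσ A hV hw1 n]
    refine lintegral_mono fun ω => ENNReal.ofReal_le_ofReal ?_
    have hM := hV.add_posSemidef (posSemidef_empCov A (fun i => η i ω) n)
    have hq := quadForm_nonneg (noiseSum A (fun i => η i ω) n w') hM.inv.posSemidef
    have hle : quadForm (V + empCov A (fun i => η i ω) n)⁻¹ (noiseSum A (fun i => η i ω) n w) ≤
        quadForm (V + empCov A (fun i => η i ω) n)⁻¹ (noiseSum A (fun i => η i ω) n w') := by
      conv_lhs => rw [hww, noiseSum_smul, quadForm_smul]
      exact mul_le_of_le_one_left hq (pow_le_one₀ hn.le hw)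
    unfold mixtureWeight
    gcongr

theorem aemeasurable_mixtureWeight (hη : IsGaussianNoise μ σ η)
    (A : Matrix (Fin d) (Fin d) ℝ) {V : Matrix (Fin d) (Fin d) ℝ} (hV : V.PosDef) (n : ℕ)
    (ν : Measure (EuclideanSpace ℝ (Fin d))) :
    AEMeasurable (fun p : Ω × EuclideanSpace ℝ (Fin d) => ENNReal.ofReal
      (mixtureWeight A V σ n (fun i => η i p.1) p.2)) (μ.prod ν) := by
  have h1 : Measurable fun p : (ℕ → EuclideanSpace ℝ (Fin d)) × EuclideanSpace ℝ (Fin d) =>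
      ENNReal.ofReal (mixtureWeight A V σ n p.1 p.2) :=
    (continuous_mixtureWeight A hV σ n).measurable.ennreal_ofReal
  have h2 : AEMeasurable (fun p : Ω × EuclideanSpace ℝ (Fin d) =>
      ((fun i => η i p.1), p.2)) (μ.prod ν) :=
    AEMeasurable.prodMk (AEMeasurable.comp_fst hη.aemeasurable_path) measurable_snd.aemeasurable
  have h3 := h1.comp_aemeasurable h2
  exact h3

/-- A seminorm that is large at some unit vector is large on a ball of radius `1/4` inside the
unit ball. -/
theorem exists_closedBall_quadForm_noiseSum_ge (A : Matrix (Fin d) (Fin d) ℝ)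
    (e : ℕ → EuclideanSpace ℝ (Fin d)) (n : ℕ) {N : Matrix (Fin d) (Fin d) ℝ}
    (hN : N.PosSemidef) {τ : ℝ} {w₁ : EuclideanSpace ℝ (Fin d)} (hw₁ : ‖w₁‖ = 1)
    (hτ : τ < quadForm N (noiseSum A e n w₁)) :
    ∃ w₀ : EuclideanSpace ℝ (Fin d), ‖w₀‖ = 1 ∧
      ∀ w ∈ Metric.closedBall ((3 / 4 : ℝ) • w₀) (1 / 4),
        τ / 4 ≤ quadForm N (noiseSum A e n w) := by
  have hcS : Continuous fun w => noiseSum A e n w := by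
    have h := (continuous_noiseSum A n).comp ((continuous_const (y := e)).prodMk continuous_id)
    exact h
  have hcq : Continuous fun w => √(quadForm N (noiseSum A e n w)) :=
    ((continuous_quadForm N).comp hcS).sqrt
  -- The maximizer on the sphere is used in place of `w₁`: then the seminorm is at most `‖h‖ q(w₀)`
  -- everywhere, and on the ball it stays above `(3/4 - 1/4) q(w₀)`. Squaring yields the factor
  -- `1/4`.
  obtain ⟨w₀, hw₀, hmax⟩ := (isCompact_sphere (0 : EuclideanSpace ℝ (Fin d)) 1).exists_isMaxOn
    ⟨w₁, by simpa using hw₁⟩ hcq.continuousOn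
  have hw₀1 : ‖w₀‖ = 1 := by simpa using hw₀
  set q : EuclideanSpace ℝ (Fin d) → ℝ := fun w => √(quadForm N (noiseSum A e n w)) with hq
  have hqs : ∀ (c : ℝ) w, q (c • w) = |c| * q w := fun c w => by
    simp only [hq, noiseSum_smul, quadForm_smul]
    rw [Real.sqrt_mul (sq_nonneg c), Real.sqrt_sq_eq_abs]
  have hqa : ∀ w w', q (w + w') ≤ q w + q w' := fun w w' => by
    simp only [hq, noiseSum_add]
    exact sqrt_quadForm_add_le _ _ hN
  have hq0 : ∀ h, q h ≤ ‖h‖ * q w₀ := by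
    intro h
    rcases eq_or_ne h 0 with rfl | hh
    · simp [hq, noiseSum, quadForm]
    · have hn : 0 < ‖h‖ := norm_pos_iff.2 hh
      have h1 : q (‖h‖⁻¹ • h) ≤ q w₀ := hmax (by simp [norm_smul, hn.ne'])
      rw [hqs, abs_of_pos (inv_pos.2 hn), inv_mul_le_iff₀ hn] at h1
      exact h1
  have hqw : τ < q w₀ ^ 2 := by
    refine hτ.trans_le ?_
    rw [← Real.sqrt_le_left (Real.sqrt_nonneg _)]
    exact hmax (by simpa using hw₁)
  refine ⟨w₀, hw₀1, fun w hw => ?_⟩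
  have hdist : ‖(3 / 4 : ℝ) • w₀ - w‖ ≤ 1 / 4 := by
    rw [← dist_eq_norm, dist_comm]; exact hw
  have hq0n : 0 ≤ q w₀ := Real.sqrt_nonneg _
  have h1 : q ((3 / 4 : ℝ) • w₀) ≤ q w + q ((3 / 4 : ℝ) • w₀ - w) := by
    have := hqa w ((3 / 4 : ℝ) • w₀ - w)
    rwa [add_sub_cancel] at this
  have h2 : q ((3 / 4 : ℝ) • w₀ - w) ≤ 1 / 4 * q w₀ :=
    (hq0 _).trans (mul_le_mul_of_nonneg_right hdist hq0n)
  rw [hqs, abs_of_pos (by norm_num)] at h1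
  have h3 : 1 / 2 * q w₀ ≤ q w := by linarith
  have h4 : q w ^ 2 = quadForm N (noiseSum A e n w) := Real.sq_sqrt (quadForm_nonneg _ hN)
  rw [← h4]
  nlinarith

/-- A uniform self-normalized tail bound. -/
theorem IsGaussianNoise.measure_noiseSum_large_le [IsProbabilityMeasure μ]
    (hη : IsGaussianNoise μ σ η) (hσ : 0 < σ) (A : Matrix (Fin d) (Fin d) ℝ)
    {V : Matrix (Fin d) (Fin d) ℝ} (hV : V.PosDef) (n : ℕ) {D : ℝ} (hD : 0 < D) (τ : ℝ) :
    μ {ω | (V + empCov A (fun i => η i ω) n).det ≤ D * V.det ∧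
        ∃ w : EuclideanSpace ℝ (Fin d), ‖w‖ = 1 ∧
          τ < quadForm (V + empCov A (fun i => η i ω) n)⁻¹ (noiseSum A (fun i => η i ω) n w)} ≤
      ENNReal.ofReal (4 ^ d * √D * Real.exp (-(τ / (8 * σ ^ 2)))) := by
  set U := Metric.closedBall (0 : EuclideanSpace ℝ (Fin d)) 1 with hU
  set vb := volume U with hvb
  have hvb0 : vb ≠ 0 := (Metric.measure_closedBall_pos _ _ one_pos).ne'
  have hvb1 : vb ≠ ⊤ := measure_closedBall_lt_top.ne
  let J : Ω → ℝ≥0∞ := fun ω =>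
    ∫⁻ w in U, ENNReal.ofReal (mixtureWeight A V σ n (fun i => η i ω) w)
  have hjoint := aemeasurable_mixtureWeight hη A hV n (volume.restrict U)
  have hJ : AEMeasurable J μ := hjoint.lintegral_prod_right'
  have hEJ : ∫⁻ ω, J ω ∂μ ≤ vb := by
    rw [lintegral_lintegral_swap hjoint]
    refine (setLIntegral_mono' (μ := volume) (s := U) (g := fun _ => 1)
      Metric.isClosed_closedBall.measurableSet fun w hw => ?_).trans_eq (by simp [hvb])
    exact hη.lintegral_mixtureWeight_le_one hσ A hV (by simpa [hU] using hw) n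
  -- The exponent is `(τ/4)/(2σ²)`, the second factor comes from the determinant ratio, and the
  -- third is the relative volume of the ball of radius `1/4`.
  set L : ℝ := Real.exp (τ / (8 * σ ^ 2)) * (√D)⁻¹ * (1 / 4) ^ d with hL_def
  have hLpos : 0 < L := by positivity
  have hsub : {ω | (V + empCov A (fun i => η i ω) n).det ≤ D * V.det ∧
        ∃ w : EuclideanSpace ℝ (Fin d), ‖w‖ = 1 ∧
          τ < quadForm (V + empCov A (fun i => η i ω) n)⁻¹
            (noiseSum A (fun i => η i ω) n w)} ⊆ {ω | ENNReal.ofReal L * vb ≤ J ω} := by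
    rintro ω ⟨hdet, w₁, hw₁, hτ⟩
    have hM := hV.add_posSemidef (posSemidef_empCov A (fun i => η i ω) n)
    obtain ⟨w₀, hw₀, hball⟩ :=
      exists_closedBall_quadForm_noiseSum_ge A _ n hM.inv.posSemidef hw₁ hτ
    set U' := Metric.closedBall ((3 / 4 : ℝ) • w₀) (1 / 4) with hU'
    have hUU : U' ⊆ U := by
      refine Metric.closedBall_subset_closedBall' ?_
      rw [dist_zero_right, norm_smul, hw₀]
      norm_num
    have hvol : volume U' = ENNReal.ofReal ((1 / 4) ^ d) * vb := by
      rw [hU', Measure.addHaar_closedBall' _ _ (by norm_num)]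
      simp [hvb, hU]
    have hlow : ∀ w ∈ U', ENNReal.ofReal (Real.exp (τ / (8 * σ ^ 2)) * (√D)⁻¹) ≤
        ENNReal.ofReal (mixtureWeight A V σ n (fun i => η i ω) w) := by
      intro w hw
      refine ENNReal.ofReal_le_ofReal ?_
      have h1 : τ / (8 * σ ^ 2) ≤ quadForm (V + empCov A (fun i => η i ω) n)⁻¹
          (noiseSum A (fun i => η i ω) n w) / (2 * σ ^ 2) := by
        rw [div_le_div_iff₀ (by positivity) (by positivity)]
        nlinarith [hball w hw, pow_pos hσ 2]
      have h2 : (√D)⁻¹ ≤ √(V.det / (V + empCov A (fun i => η i ω) n).det) := by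
        rw [← Real.sqrt_inv]
        refine Real.sqrt_le_sqrt ?_
        rw [inv_le_iff_one_le_mul₀' hD, ← mul_div_assoc, one_le_div hM.det_pos]
        exact hdet
      unfold mixtureWeight
      gcongr
    calc ENNReal.ofReal L * vb
        = ENNReal.ofReal (Real.exp (τ / (8 * σ ^ 2)) * (√D)⁻¹) * volume U' := by
          rw [hvol, ← mul_assoc, ← ENNReal.ofReal_mul (by positivity)]
      _ = ∫⁻ w in U', ENNReal.ofReal (Real.exp (τ / (8 * σ ^ 2)) * (√D)⁻¹) := by simp
      _ ≤ ∫⁻ w in U', ENNReal.ofReal (mixtureWeight A V σ n (fun i => η i ω) w) :=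
          setLIntegral_mono' Metric.isClosed_closedBall.measurableSet hlow
      _ ≤ J ω := lintegral_mono_set hUU
  have hLv0 : ENNReal.ofReal L * vb ≠ 0 :=
    mul_ne_zero (ENNReal.ofReal_pos.2 hLpos).ne' hvb0
  have hLv1 : ENNReal.ofReal L * vb ≠ ⊤ := ENNReal.mul_ne_top ENNReal.ofReal_ne_top hvb1
  refine (measure_mono hsub).trans ?_
  rw [← ENNReal.mul_le_mul_iff_right hLv0 hLv1]
  refine (mul_meas_ge_le_lintegral₀ hJ _).trans (hEJ.trans_eq ?_)
  rw [mul_right_comm, ← ENNReal.ofReal_mul hLpos.le]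
  have hone : L * (4 ^ d * √D * Real.exp (-(τ / (8 * σ ^ 2)))) = 1 := by
    rw [hL_def, Real.exp_neg, one_div, inv_pow]
    field_simp
  rw [hone, ENNReal.ofReal_one, one_mul]

end SelfNormalizedTail

/-! ### The determinant of the empirical covariance -/

section Determinant

open scoped NNReal ENNReal

variable {Ω : Type*} [MeasurableSpace Ω] {μ : Measure Ω} [IsProbabilityMeasure μ] {d : ℕ}
  {σ : ℝ} {η : ℕ → Ω → EuclideanSpace ℝ (Fin d)}

/-- Integrating out the last noise vector reproduces the recursion of the Gramian, with `x` replaced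
by `Aᵀ x`. -/
theorem IsGaussianNoise.lintegral_inner_state_sq (hη : IsGaussianNoise μ σ η)
    (A : Matrix (Fin d) (Fin d) ℝ) (t : ℕ) : ∀ x : EuclideanSpace ℝ (Fin d),
      ∫⁻ ω, ENNReal.ofReal (inner ℝ x (state A (fun i => η i ω) t) ^ 2) ∂μ =
        ENNReal.ofReal (σ ^ 2 * quadForm (gramian A t) x) := by
  induction t with
  | zero => intro x; simp [state, quadForm_gramian]
  | succ t ih =>
    intro x
    set v : ℝ≥0 := (σ ^ 2 * ‖x‖ ^ 2).toNNReal with hv_def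
    have hv : (v : ℝ) = σ ^ 2 * ‖x‖ ^ 2 := Real.coe_toNNReal _ (by positivity)
    let F : (ℕ → EuclideanSpace ℝ (Fin d)) → ℝ → ℝ≥0∞ := fun e z =>
      ENNReal.ofReal ((inner ℝ (act A.transpose x) (state A e t) + z) ^ 2)
    have hF : Measurable (Function.uncurry F) := by
      have hs := (continuous_state A t).measurable
      fun_prop
    have hdep : DependsOn F (Set.Iio t) := by
      intro e e' h
      have h1 := dependsOn_state A le_rfl h
      simp only at h1
      simp only [F, h1]
    have hstep := hη.lintegral_step t x F hF hdep
    simp only [F, ← inner_state_succ, ← hv_def, lintegral_sq_gaussianReal] at hstep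
    rw [hstep]
    have h0 : ∀ ω, ENNReal.ofReal
        (inner ℝ (act A.transpose x) (state A (fun i => η i ω) t) ^ 2 + v) =
        ENNReal.ofReal (inner ℝ (act A.transpose x) (state A (fun i => η i ω) t) ^ 2) +
          ENNReal.ofReal v := fun ω => ENNReal.ofReal_add (sq_nonneg _) v.coe_nonneg
    simp only [h0]
    rw [lintegral_add_right _ measurable_const, ih, lintegral_const, measure_univ, mul_one,
      ← ENNReal.ofReal_add (mul_nonneg (sq_nonneg _) (quadForm_nonneg _ (posSemidef_gramian A t)))
        v.coe_nonneg, hv, quadForm_gramian_succ]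
    ring_nf

theorem IsGaussianNoise.lintegral_quadForm_inv_gramian_le (hη : IsGaussianNoise μ σ η)
    (A : Matrix (Fin d) (Fin d) ℝ) {t T : ℕ} (hT : 0 < T) (htT : t ≤ T) :
    ∫⁻ ω, ENNReal.ofReal (quadForm (gramian A T)⁻¹ (state A (fun i => η i ω) t)) ∂μ ≤
      ENNReal.ofReal (σ ^ 2 * d) := by
  have hG := posDef_gramian A hT
  obtain ⟨B, hB⟩ := posSemidef_exists_transpose_mul hG.posSemidef
  have hdet : IsUnit B.det := by
    have := hG.det_pos
    rw [hB, Matrix.det_mul, Matrix.det_transpose] at this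
    exact isUnit_iff_ne_zero.2 fun h => by simp [h] at this
  have hinv : (gramian A T)⁻¹ = B⁻¹ * B⁻¹.transpose := by
    rw [hB, Matrix.mul_inv_rev, Matrix.transpose_nonsing_inv]
  -- These vectors are orthonormal for `Γ_T`; summing squares along them computes the form of
  -- `Γ_T⁻¹`, and each square has mean at most `σ²` because `Γ_t ≤ Γ_T`.
  let p : Fin d → EuclideanSpace ℝ (Fin d) := fun i => act B⁻¹ (EuclideanSpace.basisFun _ ℝ i)
  have hp : ∀ i, quadForm (gramian A T) (p i) = 1 := fun i => by
    rw [quadForm_eq_norm_sq hB, ← act_mul, Matrix.mul_nonsing_inv _ hdet, act_one,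
      (EuclideanSpace.basisFun (Fin d) ℝ).norm_eq_one, one_pow]
  have hsum : ∀ x, quadForm (gramian A T)⁻¹ x = ∑ i, inner ℝ (p i) x ^ 2 := fun x => by
    rw [hinv, quadForm_mul_transpose,
      ← (EuclideanSpace.basisFun (Fin d) ℝ).sum_sq_norm_inner_right]
    refine Finset.sum_congr rfl fun i _ => ?_
    rw [inner_act, Matrix.transpose_transpose, Real.norm_eq_abs, sq_abs]
  simp only [hsum, ENNReal.ofReal_sum_of_nonneg fun _ _ => sq_nonneg _]
  have hm : ∀ i, AEMeasurable (fun ω => ENNReal.ofReal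
      (inner ℝ (p i) (state A (fun j => η j ω) t) ^ 2)) μ := fun i => by
    have hs := (continuous_state A t).measurable
    have h : Measurable fun e => ENNReal.ofReal (inner ℝ (p i) (state A e t) ^ 2) := by fun_prop
    exact h.comp_aemeasurable hη.aemeasurable_path
  rw [lintegral_finsetSum' _ fun i _ => hm i]
  refine (Finset.sum_le_card_nsmul _ _ (ENNReal.ofReal (σ ^ 2)) fun i _ => ?_).trans_eq ?_
  · rw [hη.lintegral_inner_state_sq A t]
    refine ENNReal.ofReal_le_ofReal (mul_le_of_le_one_right (sq_nonneg σ) ?_)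
    exact (quadForm_gramian_mono A htT _).trans_eq (hp i)
  · rw [Finset.card_univ, Fintype.card_fin, nsmul_eq_mul, mul_comm (σ ^ 2),
      ENNReal.ofReal_mul (by positivity), ENNReal.ofReal_natCast]

theorem IsGaussianNoise.measure_det_large_le (hη : IsGaussianNoise μ σ η) (hσ : 0 < σ)
    (hd : 0 < d) (A : Matrix (Fin d) (Fin d) ℝ) {k T : ℕ} (hk : 0 < k) (hkT : k ≤ T) {δ : ℝ}
    (hδ : 0 < δ) (hδ1 : δ ≤ 1) :
    μ {ω | (100 * d / δ) ^ d * (gramian A T * (gramian A k)⁻¹).det * (regCov A σ T k).det <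
        (regCov A σ T k + empCov A (fun i => η i ω) (T + 1)).det} ≤ ENNReal.ofReal (δ / 3) := by
  have hT : 0 < T := hk.trans_le hkT
  have hT' : (1 : ℝ) ≤ T := by exact_mod_cast hT
  have hd' : (1 : ℝ) ≤ d := by exact_mod_cast hd
  have hG := posDef_gramian A hT
  -- Markov's threshold: the mean is at most `(T + 1)σ²d ≤ 2Tσ²d`, and the allowed failure
  -- probability is `δ/3`.
  set ρ : ℝ := 6 * T * σ ^ 2 * d / δ with hρ_def
  have hρ : 0 < ρ := by positivity
  let R : Ω → ℝ≥0∞ := fun ω => ∑ t ∈ Finset.range (T + 1),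
    ENNReal.ofReal (quadForm (gramian A T)⁻¹ (state A (fun i => η i ω) t))
  have hRt : ∀ t, AEMeasurable (fun ω => ENNReal.ofReal
      (quadForm (gramian A T)⁻¹ (state A (fun i => η i ω) t))) μ := fun t =>
    ((continuous_quadForm (gramian A T)⁻¹).comp
      (continuous_state A t)).measurable.ennreal_ofReal.comp_aemeasurable hη.aemeasurable_path
  have hR : AEMeasurable R μ := Finset.aemeasurable_fun_sum _ fun t _ => hRt t
  have hER : ∫⁻ ω, R ω ∂μ ≤ ENNReal.ofReal (ρ * (δ / 3)) := by
    rw [lintegral_finsetSum' _ fun t _ => hRt t]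
    refine (Finset.sum_le_card_nsmul _ _ (ENNReal.ofReal (σ ^ 2 * d)) fun t ht =>
      hη.lintegral_quadForm_inv_gramian_le A hT (by simpa [Nat.lt_succ_iff] using ht)).trans ?_
    rw [Finset.card_range, nsmul_eq_mul, ← ENNReal.ofReal_natCast,
      ← ENNReal.ofReal_mul (by positivity)]
    refine ENNReal.ofReal_le_ofReal ?_
    have : ρ * (δ / 3) = 2 * T * (σ ^ 2 * d) := by rw [hρ_def]; field_simp; norm_num
    rw [this]
    push_cast
    gcongr
    linarith
  have hsub : {ω | (100 * d / δ) ^ d * (gramian A T * (gramian A k)⁻¹).det *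
        (regCov A σ T k).det < (regCov A σ T k + empCov A (fun i => η i ω) (T + 1)).det} ⊆
      {ω | ENNReal.ofReal ρ ≤ R ω} := by
    intro ω hω
    by_contra hcon
    simp only [Set.mem_ofPred_eq, not_le] at hcon hω
    refine absurd hω (not_lt.2 ?_)
    have hRω : ∑ t ∈ Finset.range (T + 1),
        quadForm (gramian A T)⁻¹ (state A (fun i => η i ω) t) ≤ ρ := by
      have h := hcon
      simp only [R] at h
      rw [← ENNReal.ofReal_sum_of_nonneg fun t _ => quadForm_nonneg _ hG.inv.posSemidef,
        ENNReal.ofReal_lt_ofReal_iff hρ] at h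
      exact h.le
    -- Cauchy–Schwarz turns the bound on the sum of `⟪X_t, Γ_T⁻¹ X_t⟫` into `Y ≤ ρ Γ_T`. Here `ρ =
    -- 96 (d/δ) Tσ²/16`, and `V` adds at most one more unit of `Tσ²/16`, so `100` suffices.
    have hle : ∀ x, quadForm (regCov A σ T k + empCov A (fun i => η i ω) (T + 1)) x ≤
        quadForm ((100 * d / δ * (T * σ ^ 2 / 16)) • gramian A T) x := by
      intro x
      have hx := quadForm_nonneg x hG.posSemidef
      have h1 : quadForm (empCov A (fun i => η i ω) (T + 1)) x ≤ ρ * quadForm (gramian A T) x := by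
        rw [quadForm_empCov]
        refine (Finset.sum_le_sum fun t _ => inner_sq_le_quadForm_mul _ _ hG).trans ?_
        rw [← Finset.mul_sum, mul_comm]
        exact mul_le_mul_of_nonneg_right hRω hx
      have h2 : T * σ ^ 2 / 16 * quadForm (gramian A k) x ≤
          T * σ ^ 2 / 16 * quadForm (gramian A T) x :=
        mul_le_mul_of_nonneg_left (quadForm_gramian_mono A hkT x) (by positivity)
      rw [quadForm_add_matrix, quadForm_regCov, quadForm_smul_matrix]
      have h3 : T * σ ^ 2 / 16 + ρ ≤ 100 * d / δ * (T * σ ^ 2 / 16) := by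
        have h4 : 1 ≤ d / δ := by rw [one_le_div hδ]; linarith
        have h5 : ρ = 96 * (d / δ) * (T * σ ^ 2 / 16) := by rw [hρ_def]; ring
        have h6 : 0 < T * σ ^ 2 / 16 := by positivity
        rw [h5]
        have : 100 * d / δ = 100 * (d / δ) := by ring
        rw [this]
        nlinarith
      nlinarith [mul_le_mul_of_nonneg_right h3 hx]
    refine (det_le_det_of_quadForm_le (posDef_regCov_add_empCov A hσ hT hk _ _)
      (hG.smul (by positivity)) hle).trans_eq ?_
    have hk0 : (gramian A k).det ≠ 0 := (posDef_gramian A hk).det_pos.ne'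
    rw [Matrix.det_smul, Fintype.card_fin, det_regCov, det_gramian_mul_inv, mul_pow]
    field_simp
  refine (measure_mono hsub).trans ?_
  have h0 : ENNReal.ofReal ρ ≠ 0 := (ENNReal.ofReal_pos.2 hρ).ne'
  rw [← ENNReal.mul_le_mul_iff_right h0 ENNReal.ofReal_ne_top, ← ENNReal.ofReal_mul hρ.le]
  exact (mul_meas_ge_le_lintegral₀ hR _).trans hER

end Determinant

/-! ### Least squares -/

section LeastSquares

variable {d : ℕ} {A B : Matrix (Fin d) (Fin d) ℝ} {e : ℕ → EuclideanSpace ℝ (Fin d)} {T : ℕ}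

/-- The basic inequality for the row of the estimation error in direction `w`. -/
theorem IsOLS.quadForm_empCov_le (hB : IsOLS (state A e) T B) {w : EuclideanSpace ℝ (Fin d)}
    (hw : ‖w‖ = 1) :
    quadForm (empCov A e (T + 1)) (act (B - A).transpose w) ≤
      2 * inner ℝ (act (B - A).transpose w) (noiseSum A e (T + 1) w) := by
  set u := act (B - A).transpose w with hu
  have hux : ∀ x, inner ℝ u x = inner ℝ w (act B x) - inner ℝ w (act A x) := fun x => by
    rw [hu, ← inner_act, act_sub_matrix, inner_sub_right]
  -- A full step that removes the error in the output direction `w`: it adds `⟪u, X_t⟫ w` to each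
  -- residual.
  have h := hB (B - Matrix.vecMulVec w u)
  rw [olsLoss, olsLoss, ← sub_nonneg, ← Finset.sum_sub_distrib] at h
  have hterm : ∀ t, (1 / 2 : ℝ) * ‖state A e (t + 1) - act (B - Matrix.vecMulVec w u)
      (state A e t)‖ ^ 2 - 1 / 2 * ‖state A e (t + 1) - act B (state A e t)‖ ^ 2 =
      inner ℝ w (e t) * inner ℝ u (state A e t) - 1 / 2 * inner ℝ u (state A e t) ^ 2 := by
    intro t
    have h1 : state A e (t + 1) - act (B - Matrix.vecMulVec w u) (state A e t) =
        (state A e (t + 1) - act B (state A e t)) + (inner ℝ u (state A e t) : ℝ) • w := by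
      rw [act_sub_matrix, act_vecMulVec]; abel
    have h2 : inner ℝ (state A e (t + 1) - act B (state A e t)) w =
        inner ℝ w (e t) - inner ℝ u (state A e t) := by
      rw [real_inner_comm, inner_sub_right, hux, state, inner_add_right]; ring
    rw [h1, norm_add_sq_real, inner_smul_right, h2, norm_smul, hw, mul_one, Real.norm_eq_abs,
      sq_abs]
    ring
  simp only [hterm] at h
  -- The loss starts at `t = 1` and `empCov` at `t = 0`; the extra term vanishes as `X_0 = 0`.
  have hsub : Finset.Icc 1 T ⊆ Finset.range (T + 1) := fun t ht => by
    simp only [Finset.mem_Icc, Finset.mem_range] at ht ⊢; omega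
  rw [Finset.sum_subset hsub fun t ht ht' => ?_, Finset.sum_sub_distrib, ← Finset.mul_sum] at h
  · rw [quadForm_empCov, inner_noiseSum]
    linarith
  · obtain rfl : t = 0 := by
      simp only [Finset.mem_Icc, Finset.mem_range, not_and] at ht ht'; omega
    simp [state]

/-- Duality: `‖M x‖` is the inner product of `M x` with its own direction `w`, and `M` moves to the
other side as `Mᵀ`. -/
theorem opNorm_le_of_transpose {M : Matrix (Fin d) (Fin d) ℝ} {b : ℝ} (hb : 0 ≤ b)
    (h : ∀ w : EuclideanSpace ℝ (Fin d), ‖w‖ = 1 → ‖act M.transpose w‖ ≤ b) : opNorm M ≤ b := by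
  refine ContinuousLinearMap.opNorm_le_bound _ hb fun x => ?_
  rcases eq_or_ne (act M x) 0 with h0 | h0
  · rw [h0, norm_zero]; positivity
  have hn : 0 < ‖act M x‖ := norm_pos_iff.2 h0
  set w := ‖act M x‖⁻¹ • act M x with hw
  have hw1 : ‖w‖ = 1 := by rw [hw, norm_smul, norm_inv, norm_norm, inv_mul_cancel₀ hn.ne']
  have h1 : ‖act M x‖ = inner ℝ w (act M x) := by
    rw [hw, inner_smul_left, real_inner_self_eq_norm_sq, conj_trivial]
    field_simp
  rw [h1, inner_act]
  exact (real_inner_le_norm _ _).trans (mul_le_mul_of_nonneg_right (h w hw1) (norm_nonneg _))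

/-- Deterministic error bound for least squares. -/
theorem IsOLS.opNorm_sub_le (hB : IsOLS (state A e) T B) {V : Matrix (Fin d) (Fin d) ℝ}
    (hV : V.PosDef) {τ κ : ℝ} (hτ : 0 ≤ τ) (hκ : 0 < κ)
    (hVY : ∀ u, quadForm V u ≤ 16 * quadForm (empCov A e (T + 1)) u)
    (hY : ∀ u, κ * ‖u‖ ^ 2 ≤ quadForm (empCov A e (T + 1)) u)
    (hQ : ∀ w, ‖w‖ = 1 →
      quadForm (V + empCov A e (T + 1))⁻¹ (noiseSum A e (T + 1) w) ≤ τ) :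
    opNorm (B - A) ≤ √(68 * τ / κ) := by
  refine opNorm_le_of_transpose (Real.sqrt_nonneg _) fun w hw => Real.le_sqrt_of_sq_le ?_
  set u := act (B - A).transpose w with hu
  set Y := empCov A e (T + 1) with hY_def
  have hM := hV.add_posSemidef (posSemidef_empCov A e (T + 1))
  have h1 : quadForm Y u ≤ 2 * inner ℝ u (noiseSum A e (T + 1) w) := hB.quadForm_empCov_le hw
  have h2 := inner_sq_le_quadForm_mul u (noiseSum A e (T + 1) w) hM
  have hY0 : 0 ≤ quadForm Y u := quadForm_nonneg _ (posSemidef_empCov A e (T + 1))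
  have h3 : quadForm (V + Y) u ≤ 17 * quadForm Y u := by
    rw [quadForm_add_matrix]; linarith [hVY u]
  have h4 : inner ℝ u (noiseSum A e (T + 1) w) ^ 2 ≤ 17 * quadForm Y u * τ :=
    h2.trans (mul_le_mul h3 (hQ w hw) (quadForm_nonneg _ hM.inv.posSemidef) (by positivity))
  -- From `q ≤ 2p` and `p² ≤ 17 q τ` follows `q² ≤ 68 q τ`; dividing by `q` requires the case `q =
  -- 0` apart.
  have h5 : quadForm Y u ≤ 68 * τ := by
    rcases hY0.eq_or_lt with h | h
    · rw [← h]; positivity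
    · have h6 : quadForm Y u ^ 2 ≤ (2 * inner ℝ u (noiseSum A e (T + 1) w)) ^ 2 :=
        pow_le_pow_left₀ hY0 h1 2
      nlinarith
  rw [le_div_iff₀ hκ]
  linarith [hY u]

end LeastSquares

/-! ### The least-squares guarantee -/

section Complexity

variable {d : ℕ} (A : Matrix (Fin d) (Fin d) ℝ) {δ : ℝ} {T k : ℕ}

theorem dimension_mul_log_le_complexity (hk : 0 < k) (hkT : k ≤ T) :
    d * Real.log (d / δ) ≤ complexity A δ T k := by
  have := Real.log_nonneg (one_le_det_gramian_mul_inv A hk hkT)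
  unfold complexity
  linarith

theorem log_two_le_log_div (hd : 0 < d) (hδ : 0 < δ) (hδ2 : δ < 1 / 2) :
    Real.log 2 ≤ Real.log (d / δ) := by
  have hd' : (1 : ℝ) ≤ d := by exact_mod_cast hd
  refine Real.log_le_log (by norm_num) ?_
  rw [le_div_iff₀ hδ]
  linarith

theorem two_pow_le_exp_complexity (hd : 0 < d) (hδ : 0 < δ) (hδ2 : δ < 1 / 2) (hk : 0 < k)
    (hkT : k ≤ T) : (2 : ℝ) ^ d ≤ Real.exp (complexity A δ T k) := by
  rw [← Real.log_le_iff_le_exp (by positivity), Real.log_pow]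
  exact (mul_le_mul_of_nonneg_left (log_two_le_log_div hd hδ hδ2) (Nat.cast_nonneg d)).trans
    (dimension_mul_log_le_complexity A hk hkT)

theorem two_le_exp_complexity (hd : 0 < d) (hδ : 0 < δ) (hδ2 : δ < 1 / 2) (hk : 0 < k)
    (hkT : k ≤ T) : 2 ≤ Real.exp (complexity A δ T k) :=
  (le_self_pow₀ (by norm_num) hd.ne').trans (two_pow_le_exp_complexity A hd hδ hδ2 hk hkT)

theorem exp_complexity (hd : 0 < d) (hδ : 0 < δ) (hk : 0 < k) (hkT : k ≤ T) :
    Real.exp (complexity A δ T k) =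
      (d / δ) ^ d * (gramian A T * (gramian A k)⁻¹).det := by
  have hd' : (0 : ℝ) < d := by exact_mod_cast hd
  rw [complexity, Real.exp_add, Real.exp_log
    (one_pos.trans_le (one_le_det_gramian_mul_inv A hk hkT)), Real.exp_nat_mul,
    Real.exp_log (by positivity)]

theorem inv_le_exp_complexity (hd : 0 < d) (hδ : 0 < δ) (hδ2 : δ < 1 / 2) (hk : 0 < k)
    (hkT : k ≤ T) : δ⁻¹ ≤ Real.exp (complexity A δ T k) := by
  have hd' : (1 : ℝ) ≤ d := by exact_mod_cast hd
  have h1 : δ⁻¹ ≤ d / δ := by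
    rw [div_eq_mul_inv]; exact le_mul_of_one_le_left (by positivity) hd'
  have h2 : 1 ≤ d / δ := by rw [one_le_div hδ]; linarith
  rw [exp_complexity A hd hδ hk hkT]
  calc δ⁻¹ ≤ (d / δ) ^ d := h1.trans (le_self_pow₀ h2 hd.ne')
    _ ≤ _ := le_mul_of_one_le_right (by positivity) (one_le_det_gramian_mul_inv A hk hkT)

theorem complexity_pos (hd : 0 < d) (hδ : 0 < δ) (hδ2 : δ < 1 / 2) (hk : 0 < k)
    (hkT : k ≤ T) : 0 < complexity A δ T k := by
  rw [← Real.one_lt_exp_iff]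
  linarith [two_le_exp_complexity A hd hδ hδ2 hk hkT]

end Complexity

section Guarantee

open scoped NNReal ENNReal

variable {Ω : Type*} [MeasurableSpace Ω] {μ : Measure Ω} [IsProbabilityMeasure μ] {d : ℕ}
  {σ : ℝ} {η : ℕ → Ω → EuclideanSpace ℝ (Fin d)}

theorem IsGaussianNoise.measure_opNorm_sub_le (hη : IsGaussianNoise μ σ η) (hσ : 0 < σ)
    (hd : 0 < d) {A : Matrix (Fin d) (Fin d) ℝ} {Ahat : Ω → Matrix (Fin d) (Fin d) ℝ}
    {k T : ℕ} (hk : 0 < k) {δ : ℝ} (hδ : 0 < δ) (hδ2 : δ < 1 / 2) (h2k : 2 * k ≤ T)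
    (hT : 80 * complexity A δ T k ≤ (T : ℝ) / k)
    (hA : ∀ ω, IsOLS (state A (fun t => η t ω)) T (Ahat ω)) {C : ℝ} (hC : 1120 ≤ C) :
    μ {ω | C / √(T * lambdaMin (gramian A k)) * √(complexity A δ T k) < opNorm (Ahat ω - A)} ≤
      ENNReal.ofReal δ := by
  have hkT : k ≤ T := by omega
  have hT0 : 0 < T := hk.trans_le hkT
  have hk' : (0 : ℝ) < k := by positivity
  have hT' : (0 : ℝ) < T := by positivity
  have hd' : (0 : ℝ) < d := by positivity
  have hlam : 1 ≤ lambdaMin (gramian A k) := one_le_lambdaMin_gramian hd A hk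
  set lam := lambdaMin (gramian A k) with hlam_def
  have hx := complexity_pos A hd hδ hδ2 hk hkT
  have h2 := two_pow_le_exp_complexity A hd hδ hδ2 hk hkT
  have h2' := two_le_exp_complexity A hd hδ hδ2 hk hkT
  have hinv := inv_le_exp_complexity A hd hδ hδ2 hk hkT
  have hexp := exp_complexity A hd hδ hk hkT
  have hr := one_le_det_gramian_mul_inv A hk hkT
  set x := complexity A δ T k with hx_def
  set r := (gramian A T * (gramian A k)⁻¹).det with hr_def
  set E := Real.exp x with hE_def
  have hE : 0 < E := Real.exp_pos x
  have hEn : ∀ n : ℕ, Real.exp (n * x) = E ^ n := fun n => Real.exp_nat_mul x n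
  -- All failure probabilities are measured in powers of `E = exp(complexity)`, which dominates
  -- `2^d`, `2` and `1/δ`. Each must come out as `E⁻³ ≤ δ/3`.
  have hpow : ∀ (a : ℝ) (n : ℕ), 0 ≤ a → a ≤ 2 ^ n → a ^ d ≤ E ^ n := fun a n ha han => by
    calc a ^ d ≤ (2 ^ n) ^ d := pow_le_pow_left₀ ha han d
      _ = (2 ^ d) ^ n := by rw [← pow_mul, ← pow_mul, mul_comm]
      _ ≤ E ^ n := pow_le_pow_left₀ (by positivity) h2 n
  set D : ℝ := (100 * d / δ) ^ d * r with hD_def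
  have hD : 0 < D := by positivity
  have hDE : √D ≤ E ^ 4 := by
    refine Real.sqrt_le_iff.2 ⟨by positivity, ?_⟩
    calc D = 100 ^ d * E := by rw [hD_def, hexp, mul_div_assoc, mul_pow]; ring
      _ ≤ E ^ 7 * E := by
        gcongr
        exact hpow 100 7 (by norm_num) (by norm_num)
      _ = (E ^ 4) ^ 2 := by ring
  have hδE : (E ^ 3)⁻¹ ≤ δ / 3 := by
    rw [inv_le_comm₀ (by positivity) (by positivity), inv_div]
    have h4 : 4 ≤ E ^ 2 := by nlinarith
    calc 3 / δ = 3 * δ⁻¹ := div_eq_mul_inv _ _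
      _ ≤ E ^ 2 * E := mul_le_mul (by linarith) hinv (by positivity) (by positivity)
      _ = E ^ 3 := by ring
  -- The number of full blocks. Since `T ≥ 2k`, rounding loses at most a factor two, so `m ≥
  -- T/(4k)`, twice the `T/(8k)` lost on the ellipsoid.
  set m := ⌊(T : ℝ) / (2 * k)⌋₊ with hm_def
  have hm : 2 * k * m ≤ T + 1 := by
    have h1 : (m : ℝ) ≤ T / (2 * k) := Nat.floor_le (by positivity)
    rw [le_div_iff₀ (by positivity)] at h1
    have : m * (2 * k) ≤ T := by exact_mod_cast h1
    rw [mul_comm]; omega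
  have hm' : (T : ℝ) / (4 * k) ≤ m := by
    have h1 : (T : ℝ) / (2 * k) < m + 1 := Nat.lt_floor_add_one _
    have h2 : 1 ≤ m := (Nat.one_le_floor_iff _).2 (by
      rw [one_le_div (by positivity)]; exact_mod_cast h2k)
    have h3 : (1 : ℝ) ≤ m := by exact_mod_cast h2
    have h4 : (T : ℝ) / (4 * k) = T / (2 * k) / 2 := by field_simp; norm_num
    rw [h4]
    linarith
  set V := regCov A σ T k with hV_def
  have hV : V.PosDef := posDef_regCov A hσ hT0 hk
  -- Chosen so that `τ/(8σ²) = 9x`: the product `E² · E⁴ · E⁻⁹` is then `E⁻³`.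
  set τ : ℝ := 72 * σ ^ 2 * x with hτ_def
  have hτ : 0 ≤ τ := by positivity
  set E₁ := {ω | D * V.det < (V + empCov A (fun i => η i ω) (T + 1)).det} with hE₁
  set E₂ := {ω | (V + empCov A (fun i => η i ω) (T + 1)).det ≤ D * V.det ∧
    ∃ u, quadForm (empCov A (fun i => η i ω) (T + 1)) u <
      T * σ ^ 2 / 256 * quadForm (gramian A k) u} with hE₂
  set E₃ := {ω | (V + empCov A (fun i => η i ω) (T + 1)).det ≤ D * V.det ∧
    ∃ w : EuclideanSpace ℝ (Fin d), ‖w‖ = 1 ∧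
      τ < quadForm (V + empCov A (fun i => η i ω) (T + 1))⁻¹
        (noiseSum A (fun i => η i ω) (T + 1) w)} with hE₃
  have hP₁ : μ E₁ ≤ ENNReal.ofReal (δ / 3) :=
    hη.measure_det_large_le hσ hd A hk hkT hδ (by linarith)
  have hP₂ : μ E₂ ≤ ENNReal.ofReal (δ / 3) := by
    refine (hη.measure_empCov_small_le hσ A hk hT0 hm hD).trans (ENNReal.ofReal_le_ofReal ?_)
    have h10 : (T : ℝ) / (8 * k) - m ≤ -(10 * x) := by
      have h8 : (T : ℝ) / (8 * k) = T / k / 8 := by field_simp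
      have h4 : (T : ℝ) / (4 * k) = T / k / 4 := by field_simp
      rw [h8]
      rw [h4] at hm'
      linarith
    calc 5 ^ d * √D * Real.exp (T / (8 * k) - m)
        ≤ E ^ 3 * E ^ 4 * Real.exp (-(10 * x)) := by
          have := hpow 5 3 (by norm_num) (by norm_num)
          gcongr
      _ = (E ^ 3)⁻¹ := by
          have := hEn 10
          push_cast at this
          rw [Real.exp_neg, this]
          field_simp
      _ ≤ δ / 3 := hδE
  have hP₃ : μ E₃ ≤ ENNReal.ofReal (δ / 3) := by
    refine (hη.measure_noiseSum_large_le hσ A hV (T + 1) hD τ).trans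
      (ENNReal.ofReal_le_ofReal ?_)
    have h9 : τ / (8 * σ ^ 2) = 9 * x := by rw [hτ_def]; field_simp; norm_num
    calc 4 ^ d * √D * Real.exp (-(τ / (8 * σ ^ 2)))
        ≤ E ^ 2 * E ^ 4 * Real.exp (-(9 * x)) := by
          have := hpow 4 2 (by norm_num) (by norm_num)
          rw [h9]
          gcongr
      _ = (E ^ 3)⁻¹ := by
          have := hEn 9
          push_cast at this
          rw [Real.exp_neg, this]
          field_simp
      _ ≤ δ / 3 := hδE
  -- The bad set lies in three events determined by the noise alone, so no measurability of `Ahat`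
  -- is needed.
  have hsub : {ω | C / √(T * lam) * √x < opNorm (Ahat ω - A)} ⊆ E₁ ∪ E₂ ∪ E₃ := by
    intro ω hω
    by_contra hcon
    simp only [Set.mem_union, not_or] at hcon
    obtain ⟨⟨h₁, h₂⟩, h₃⟩ := hcon
    have hdet : (V + empCov A (fun i => η i ω) (T + 1)).det ≤ D * V.det := not_lt.1 h₁
    have hlow : ∀ u, T * σ ^ 2 / 256 * quadForm (gramian A k) u ≤
        quadForm (empCov A (fun i => η i ω) (T + 1)) u := fun u => by
      by_contra hu
      exact h₂ ⟨hdet, u, not_le.1 hu⟩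
    have hQ : ∀ w : EuclideanSpace ℝ (Fin d), ‖w‖ = 1 →
        quadForm (V + empCov A (fun i => η i ω) (T + 1))⁻¹
          (noiseSum A (fun i => η i ω) (T + 1) w) ≤ τ := fun w hw => by
      by_contra hu
      exact h₃ ⟨hdet, w, hw, not_le.1 hu⟩
    have hbound := (hA ω).opNorm_sub_le hV (κ := T * σ ^ 2 / 256 * lam) hτ (by positivity)
      (fun u => by rw [hV_def, quadForm_regCov]; linarith [hlow u])
      (fun u => by
        refine le_trans ?_ (hlow u)
        rw [mul_assoc]
        exact mul_le_mul_of_nonneg_left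
          (lambdaMin_mul_le_quadForm (posDef_gramian A hk).isHermitian u) (by positivity)) hQ
    refine absurd hω (not_lt.2 (hbound.trans (Real.sqrt_le_iff.2 ⟨by positivity, ?_⟩)))
    rw [mul_pow, div_pow, Real.sq_sqrt (by positivity), Real.sq_sqrt hx.le, hτ_def]
    -- The constant is `68 · 72 · 256`, just below `1120²`.
    have h6 : 68 * (72 * σ ^ 2 * x) / (T * σ ^ 2 / 256 * lam) =
        1253376 / (T * lam) * x := by
      field_simp
      norm_num
    rw [h6]
    gcongr
    nlinarith
  refine (measure_mono hsub).trans ?_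
  refine (measure_union_le _ _).trans ((add_le_add (measure_union_le _ _) le_rfl).trans
    ((add_le_add (add_le_add hP₁ hP₂) hP₃).trans_eq ?_))
  rw [← ENNReal.ofReal_add (by positivity) (by positivity),
    ← ENNReal.ofReal_add (by positivity) (by positivity)]
  congr 1
  ring

end Guarantee

/-! ### Diagonalizable systems -/

section CondNumber

variable {d : ℕ} {S : Matrix (Fin d) (Fin d) ℂ}

/-- The action of a complex matrix on Euclidean space. -/
noncomputable def actC (M : Matrix (Fin d) (Fin d) ℂ) :
    EuclideanSpace ℂ (Fin d) →L[ℂ] EuclideanSpace ℂ (Fin d) :=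
  Matrix.toEuclideanCLM (n := Fin d) (𝕜 := ℂ) M

theorem actC_mul (M N : Matrix (Fin d) (Fin d) ℂ) (z : EuclideanSpace ℂ (Fin d)) :
    actC (M * N) z = actC M (actC N z) := by
  simp [actC, map_mul]

theorem actC_one (z : EuclideanSpace ℂ (Fin d)) :
    actC (1 : Matrix (Fin d) (Fin d) ℂ) z = z := by
  simp [actC, map_one]

theorem norm_actC_conjTranspose (M : Matrix (Fin d) (Fin d) ℂ) :
    ‖actC M.conjTranspose‖ = ‖actC M‖ := by
  rw [actC, ← Matrix.star_eq_conjTranspose, map_star, ContinuousLinearMap.star_eq_adjoint]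
  exact LinearIsometryEquiv.norm_map ContinuousLinearMap.adjoint _

theorem re_inner_conjTranspose_mul_self (S : Matrix (Fin d) (Fin d) ℂ)
    (z : EuclideanSpace ℂ (Fin d)) :
    RCLike.re (inner ℂ z (Matrix.toEuclideanLin (S.conjTranspose * S) z)) = ‖actC S z‖ ^ 2 := by
  have h : Matrix.toEuclideanLin (S.conjTranspose * S) z =
      ContinuousLinearMap.adjoint (actC S) (actC S z) := by
    rw [← ContinuousLinearMap.star_eq_adjoint]
    simp only [actC]
    rw [← map_star, Matrix.star_eq_conjTranspose]
    exact actC_mul _ _ _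
  rw [h, ContinuousLinearMap.adjoint_inner_right, inner_self_eq_norm_sq]

theorem isHermitian_conjTranspose_mul_self (S : Matrix (Fin d) (Fin d) ℂ) :
    (S.conjTranspose * S).IsHermitian := Matrix.isHermitian_conjTranspose_mul_self S

open scoped ComplexOrder in
theorem lambdaMin_conjTranspose_mul_self_pos (hd : 0 < d) (hS : IsUnit S.det) :
    0 < lambdaMin (S.conjTranspose * S) := by
  have hH := isHermitian_conjTranspose_mul_self S
  have hpos : (S.conjTranspose * S).PosDef :=
    Matrix.PosDef.conjTranspose_mul_self S
      (Matrix.mulVec_injective_iff_isUnit.2 ((Matrix.isUnit_iff_isUnit_det S).2 hS))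
  have hmem := (nonempty_spectrum_of_isHermitian hd hH).csInf_mem
    (finite_spectrum_of_isHermitian hH)
  rw [hH.spectrum_real_eq_range_eigenvalues] at hmem
  obtain ⟨i, hi⟩ := hmem
  rw [lambdaMin, hH.spectrum_real_eq_range_eigenvalues, ← hi]
  exact hpos.eigenvalues_pos i

theorem lambdaMin_le_lambdaMax (hd : 0 < d) {M : Matrix (Fin d) (Fin d) ℂ}
    (hM : M.IsHermitian) : lambdaMin M ≤ lambdaMax M := by
  obtain ⟨a, ha⟩ := nonempty_spectrum_of_isHermitian hd hM
  exact (csInf_le (finite_spectrum_of_isHermitian hM).bddBelow ha).trans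
    (le_csSup (finite_spectrum_of_isHermitian hM).bddAbove ha)

theorem condNumber_sq (hd : 0 < d) (hS : IsUnit S.det) :
    condNumber S ^ 2 = lambdaMax (S.conjTranspose * S) / lambdaMin (S.conjTranspose * S) := by
  have h1 := lambdaMin_conjTranspose_mul_self_pos hd hS
  have h2 := lambdaMin_le_lambdaMax hd (isHermitian_conjTranspose_mul_self S)
  exact Real.sq_sqrt (div_nonneg (h1.le.trans h2) h1.le)

theorem one_le_condNumber (hd : 0 < d) (hS : IsUnit S.det) : 1 ≤ condNumber S := by
  have h1 := lambdaMin_conjTranspose_mul_self_pos hd hS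
  have h2 := lambdaMin_le_lambdaMax hd (isHermitian_conjTranspose_mul_self S)
  exact Real.one_le_sqrt.2 ((one_le_div h1).2 h2)

/-- The eigenvalues of `S* S` control `S`, whereas `Γ_t` involves transposed powers and hence `S*`;
the two have equal operator norm. -/
theorem norm_actC_conjTranspose_sq_le (hd : 0 < d) (hS : IsUnit S.det)
    (z : EuclideanSpace ℂ (Fin d)) :
    ‖actC S.conjTranspose z‖ ^ 2 ≤ lambdaMax (S.conjTranspose * S) * ‖z‖ ^ 2 := by
  have h1 := lambdaMin_conjTranspose_mul_self_pos hd hS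
  have h2 := lambdaMin_le_lambdaMax hd (isHermitian_conjTranspose_mul_self S)
  have h3 : 0 ≤ lambdaMax (S.conjTranspose * S) := h1.le.trans h2
  have hn : ‖actC S‖ ≤ √(lambdaMax (S.conjTranspose * S)) := by
    refine ContinuousLinearMap.opNorm_le_bound _ (Real.sqrt_nonneg _) fun u => ?_
    have := le_lambdaMax_mul (isHermitian_conjTranspose_mul_self S) u
    rw [re_inner_conjTranspose_mul_self] at this
    refine le_of_sq_le_sq ?_ (by positivity)
    rwa [mul_pow, Real.sq_sqrt h3]
  rw [← norm_actC_conjTranspose] at hn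
  calc ‖actC S.conjTranspose z‖ ^ 2 ≤ (√(lambdaMax (S.conjTranspose * S)) * ‖z‖) ^ 2 :=
        pow_le_pow_left₀ (norm_nonneg _) (((actC S.conjTranspose).le_opNorm z).trans
          (mul_le_mul_of_nonneg_right hn (norm_nonneg z))) 2
    _ = _ := by rw [mul_pow, Real.sq_sqrt h3]

theorem lambdaMin_mul_norm_actC_inv_conjTranspose_sq_le (hd : 0 < d) (hS : IsUnit S.det)
    (z : EuclideanSpace ℂ (Fin d)) :
    lambdaMin (S.conjTranspose * S) * ‖actC S⁻¹.conjTranspose z‖ ^ 2 ≤ ‖z‖ ^ 2 := by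
  set a := lambdaMin (S.conjTranspose * S) with ha_def
  have ha : 0 < a := lambdaMin_conjTranspose_mul_self_pos hd hS
  have hn : ‖actC S⁻¹‖ ≤ (√a)⁻¹ := by
    refine ContinuousLinearMap.opNorm_le_bound _ (by positivity) fun u => ?_
    have := lambdaMin_mul_le (isHermitian_conjTranspose_mul_self S) (actC S⁻¹ u)
    rw [re_inner_conjTranspose_mul_self, ← actC_mul, Matrix.mul_nonsing_inv _ hS, actC_one] at this
    refine le_of_sq_le_sq ?_ (by positivity)
    rw [mul_pow, inv_pow, Real.sq_sqrt ha.le, le_inv_mul_iff₀ ha]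
    exact this
  rw [← norm_actC_conjTranspose] at hn
  have h1 : ‖actC S⁻¹.conjTranspose z‖ ^ 2 ≤ ((√a)⁻¹ * ‖z‖) ^ 2 :=
    pow_le_pow_left₀ (norm_nonneg _) (((actC S⁻¹.conjTranspose).le_opNorm z).trans
          (mul_le_mul_of_nonneg_right hn (norm_nonneg z))) 2
  rwa [mul_pow, inv_pow, Real.sq_sqrt ha.le, le_inv_mul_iff₀ ha] at h1

theorem toComplex_pow {A : Matrix (Fin d) (Fin d) ℝ} {v : Fin d → ℂ}
    (h : IsDiagonalization A S v) (s : ℕ) :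
    toComplex (A ^ s) = S * Matrix.diagonal (fun i => v i ^ s) * S⁻¹ := by
  have hmap : toComplex (A ^ s) = toComplex A ^ s := map_pow Complex.ofRealHom.mapMatrix A s
  rw [hmap]
  induction s with
  | zero => simp [Matrix.mul_nonsing_inv _ h.1]
  | succ s ih =>
    rw [pow_succ, ih (map_pow Complex.ofRealHom.mapMatrix A s), h.2]
    have hS : S⁻¹ * S = 1 := Matrix.nonsing_inv_mul _ h.1
    calc S * Matrix.diagonal (fun i => v i ^ s) * S⁻¹ * (S * Matrix.diagonal v * S⁻¹)
        = S * Matrix.diagonal (fun i => v i ^ s) * (S⁻¹ * S) * Matrix.diagonal v * S⁻¹ := by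
          simp only [Matrix.mul_assoc]
      _ = _ := by
          rw [hS, Matrix.mul_one, Matrix.mul_assoc S, Matrix.diagonal_mul_diagonal]
          simp only [pow_succ]

/-- In the eigenbasis, the powers of a diagonalizable matrix act on a fixed vector of moduli up to
the condition number. -/
theorem IsDiagonalization.exists_norm_act_bounds (hd : 0 < d) {A : Matrix (Fin d) (Fin d) ℝ}
    {v : Fin d → ℂ} (h : IsDiagonalization A S v) (x : EuclideanSpace ℝ (Fin d)) :
    ∃ y : Fin d → ℝ, (∀ i, 0 ≤ y i) ∧
      lambdaMin (S.conjTranspose * S) * ‖x‖ ^ 2 ≤ ∑ i, y i ∧ ∀ s : ℕ,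
        ∑ i, ‖v i‖ ^ (2 * s) * y i ≤
          lambdaMax (S.conjTranspose * S) * ‖act (A ^ s).transpose x‖ ^ 2 ∧
        lambdaMin (S.conjTranspose * S) * ‖act (A ^ s).transpose x‖ ^ 2 ≤
          ∑ i, ‖v i‖ ^ (2 * s) * y i := by
  let cx : EuclideanSpace ℝ (Fin d) → EuclideanSpace ℂ (Fin d) := fun x =>
    WithLp.toLp 2 fun i => (x i : ℂ)
  have hcx : ∀ x, ‖cx x‖ ^ 2 = ‖x‖ ^ 2 := fun x => by
    simp [cx, EuclideanSpace.norm_sq_eq]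
  have hact : ∀ (M : Matrix (Fin d) (Fin d) ℝ) x, cx (act M x) = actC (toComplex M) (cx x) := by
    intro M x
    ext i
    simp [cx, act, actC, toComplex, Matrix.mulVec, dotProduct]
  have hSH : S⁻¹.conjTranspose * S.conjTranspose = 1 := by
    rw [← Matrix.conjTranspose_mul, Matrix.mul_nonsing_inv _ h.1, Matrix.conjTranspose_one]
  have hSH' : S.conjTranspose * S⁻¹.conjTranspose = 1 := by
    rw [← Matrix.conjTranspose_mul, Matrix.nonsing_inv_mul _ h.1, Matrix.conjTranspose_one]
  -- As `A` is real, `(A^s)ᵀ` is also the adjoint `S⁻* (D^s)* S*`; in the coordinates `u = S* x` it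
  -- is diagonal up to the outer factor `S⁻*`.
  set u := actC S.conjTranspose (cx x) with hu
  refine ⟨fun i => ‖u i‖ ^ 2, fun i => by positivity, ?_, fun s => ?_⟩
  · have h1 := lambdaMin_mul_norm_actC_inv_conjTranspose_sq_le hd h.1 u
    rw [hu, ← actC_mul, hSH, actC_one, hcx, ← hu, EuclideanSpace.norm_sq_eq u] at h1
    exact h1
  · set ys := actC (Matrix.diagonal fun i => v i ^ s).conjTranspose u with hys
    have hnorm : ‖ys‖ ^ 2 = ∑ i, ‖v i‖ ^ (2 * s) * ‖u i‖ ^ 2 := by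
      rw [EuclideanSpace.norm_sq_eq]
      refine Finset.sum_congr rfl fun i _ => ?_
      have : ys i = star (v i ^ s) * u i := by
        simp [hys, actC, Matrix.diagonal_conjTranspose, Matrix.mulVec_diagonal]
      rw [this, norm_mul, norm_star, norm_pow, mul_pow, ← pow_mul, mul_comm s]
    have htr : toComplex (A ^ s).transpose = (toComplex (A ^ s)).conjTranspose := by
      ext i j
      simp only [toComplex, Matrix.map_apply, Matrix.transpose_apply,
        Matrix.conjTranspose_apply, Complex.star_def, Complex.conj_ofReal]
    have hAs : cx (act (A ^ s).transpose x) = actC S⁻¹.conjTranspose ys := by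
      rw [hact, htr, toComplex_pow h, Matrix.conjTranspose_mul, Matrix.conjTranspose_mul,
        actC_mul, actC_mul]
    have hys' : actC S.conjTranspose (cx (act (A ^ s).transpose x)) = ys := by
      rw [hAs, ← actC_mul, hSH', actC_one]
    constructor
    · rw [← hnorm, ← hcx, ← hys']
      exact norm_actC_conjTranspose_sq_le hd h.1 _
    · rw [← hnorm, ← hcx, hAs]
      exact lambdaMin_mul_norm_actC_inv_conjTranspose_sq_le hd h.1 _

theorem mem_spectrum_of_isDiagonalization {A : Matrix (Fin d) (Fin d) ℝ} {v : Fin d → ℂ}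
    (h : IsDiagonalization A S v) (i : Fin d) : v i ∈ spectrum ℂ (toComplex A) := by
  obtain ⟨U, hU⟩ := (Matrix.isUnit_iff_isUnit_det S).2 h.1
  have hinv : S⁻¹ = (U⁻¹ : (Matrix (Fin d) (Fin d) ℂ)ˣ) := by
    rw [← hU, Matrix.coe_units_inv]
  rw [h.2, hinv, ← hU, spectrum.units_conjugate, spectrum_diagonal]
  exact ⟨i, rfl⟩

theorem norm_le_one_of_spectralRadius_le {A : Matrix (Fin d) (Fin d) ℝ} {v : Fin d → ℂ}
    (h : IsDiagonalization A S v) (hA : spectralRadius ℂ (toComplex A) ≤ 1) (i : Fin d) :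
    ‖v i‖ ≤ 1 := by
  have h1 : (‖v i‖₊ : ENNReal) ≤ 1 :=
    (le_iSup₂ (f := fun z (_ : z ∈ spectrum ℂ (toComplex A)) => (‖z‖₊ : ENNReal)) (v i)
      (mem_spectrum_of_isDiagonalization h i)).trans hA
  exact_mod_cast h1

theorem minEigModulus_le {A : Matrix (Fin d) (Fin d) ℝ} {v : Fin d → ℂ}
    (h : IsDiagonalization A S v) (i : Fin d) : minEigModulus A ≤ ‖v i‖ :=
  csInf_le ⟨0, by rintro _ ⟨z, _, rfl⟩; exact norm_nonneg z⟩
    ⟨v i, mem_spectrum_of_isDiagonalization h i, rfl⟩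

theorem minEigModulus_nonneg (A : Matrix (Fin d) (Fin d) ℝ) : 0 ≤ minEigModulus A :=
  Real.sInf_nonneg (by rintro _ ⟨z, _, rfl⟩; exact norm_nonneg z)

/-- Cut into `n` blocks of length `k`; as `q ≤ 1`, the first is the largest. -/
theorem geom_sum_mul_le {q : ℝ} (hq0 : 0 ≤ q) (hq1 : q ≤ 1) (k n : ℕ) :
    ∑ s ∈ Finset.range (k * n), q ^ s ≤ n * ∑ s ∈ Finset.range k, q ^ s := by
  induction n with
  | zero => simp
  | succ n ih =>
    rw [Nat.mul_succ, Finset.sum_range_add]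
    have : ∑ s ∈ Finset.range k, q ^ (k * n + s) ≤ ∑ s ∈ Finset.range k, q ^ s :=
      Finset.sum_le_sum fun s _ => pow_le_pow_of_le_one hq0 hq1 (by omega)
    push_cast
    linarith

/-- In the eigenbasis both Gramians are weighted sums of geometric sums with ratios `|v_i|² ≤ 1`,
compared blockwise; passing to the eigenbasis and back costs `cond(S)²`. -/
theorem IsDiagonalization.quadForm_gramian_le (hd : 0 < d) {A : Matrix (Fin d) (Fin d) ℝ}
    {v : Fin d → ℂ} (h : IsDiagonalization A S v)
    (hA : spectralRadius ℂ (toComplex A) ≤ 1) {T k n : ℕ} (hTn : T ≤ k * n)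
    (x : EuclideanSpace ℝ (Fin d)) :
    quadForm (gramian A T) x ≤ condNumber S ^ 2 * n * quadForm (gramian A k) x := by
  obtain ⟨y, hy0, -, hy⟩ := h.exists_norm_act_bounds hd x
  have ha := lambdaMin_conjTranspose_mul_self_pos hd h.1
  rw [condNumber_sq hd h.1]
  set a := lambdaMin (S.conjTranspose * S)
  set b := lambdaMax (S.conjTranspose * S)
  have h1 : a * quadForm (gramian A T) x ≤
      ∑ i, (∑ s ∈ Finset.range T, ‖v i‖ ^ (2 * s)) * y i := by
    rw [quadForm_gramian, Finset.mul_sum]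
    refine (Finset.sum_le_sum fun s _ => (hy s).2).trans_eq ?_
    rw [Finset.sum_comm]
    simp only [Finset.sum_mul]
  have h2 : ∑ i, (∑ s ∈ Finset.range k, ‖v i‖ ^ (2 * s)) * y i ≤
      b * quadForm (gramian A k) x := by
    rw [quadForm_gramian, Finset.mul_sum]
    refine le_trans (le_of_eq ?_) (Finset.sum_le_sum fun s _ => (hy s).1)
    rw [Finset.sum_comm]
    simp only [Finset.sum_mul]
  have h3 : ∑ i, (∑ s ∈ Finset.range T, ‖v i‖ ^ (2 * s)) * y i ≤
      n * ∑ i, (∑ s ∈ Finset.range k, ‖v i‖ ^ (2 * s)) * y i := by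
    rw [Finset.mul_sum]
    refine Finset.sum_le_sum fun i _ => ?_
    rw [← mul_assoc]
    refine mul_le_mul_of_nonneg_right ?_ (hy0 i)
    have hv := norm_le_one_of_spectralRadius_le h hA i
    simp only [pow_mul]
    refine le_trans ?_ (geom_sum_mul_le (sq_nonneg ‖v i‖) (pow_le_one₀ (norm_nonneg _) hv) k n)
    exact Finset.sum_le_sum_of_subset_of_nonneg (Finset.range_mono hTn) fun _ _ _ => by positivity
  have h4 : a * quadForm (gramian A T) x ≤ n * (b * quadForm (gramian A k) x) :=
    h1.trans (h3.trans (mul_le_mul_of_nonneg_left h2 (Nat.cast_nonneg n)))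
  rw [div_mul_eq_mul_div, div_mul_eq_mul_div, le_div_iff₀ ha]
  linarith

theorem IsDiagonalization.log_det_gramian_le (hd : 0 < d) {A : Matrix (Fin d) (Fin d) ℝ}
    {v : Fin d → ℂ} (h : IsDiagonalization A S v)
    (hA : spectralRadius ℂ (toComplex A) ≤ 1) {T k : ℕ} (hk : 0 < k) (hkT : k ≤ T) :
    Real.log (gramian A T * (gramian A k)⁻¹).det ≤
      d * (2 * Real.log (condNumber S) + Real.log (2 * (T / k : ℝ))) := by
  have hk' : (0 : ℝ) < k := by positivity
  have hT : 0 < T := hk.trans_le hkT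
  have hX : 1 ≤ (T : ℝ) / k := (one_le_div hk').2 (by exact_mod_cast hkT)
  have hκ := one_le_condNumber hd h.1
  set n := ⌈(T : ℝ) / k⌉₊ with hn_def
  have hn : T ≤ k * n := by
    have h1 : (T : ℝ) / k ≤ n := Nat.le_ceil _
    rw [div_le_iff₀ hk'] at h1
    have : T ≤ n * k := by exact_mod_cast h1
    linarith
  -- Rounding up at most doubles a number that is at least `1`.
  have hn2 : (n : ℝ) ≤ 2 * (T / k) := by
    have := Nat.ceil_lt_add_one (zero_le_one.trans hX)
    linarith
  have hn0 : (0 : ℝ) < n := lt_of_lt_of_le (by linarith) (Nat.le_ceil _)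
  have hdet : (gramian A T).det ≤ (condNumber S ^ 2 * n) ^ d * (gramian A k).det := by
    refine (det_le_det_of_quadForm_le (posDef_gramian A hT)
      ((posDef_gramian A hk).smul (show 0 < condNumber S ^ 2 * n by positivity))
      fun x => ?_).trans_eq (by rw [Matrix.det_smul, Fintype.card_fin])
    rw [quadForm_smul_matrix]
    exact h.quadForm_gramian_le hd hA hn x
  have hlog : Real.log (gramian A T * (gramian A k)⁻¹).det ≤
      Real.log ((condNumber S ^ 2 * n) ^ d) := by
    refine Real.log_le_log (one_pos.trans_le (one_le_det_gramian_mul_inv A hk hkT)) ?_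
    rw [det_gramian_mul_inv, div_le_iff₀ (posDef_gramian A hk).det_pos]
    exact hdet
  refine hlog.trans ?_
  rw [Real.log_pow, Real.log_mul (by positivity) hn0.ne', Real.log_pow]
  have := Real.log_le_log hn0 hn2
  push_cast
  gcongr

theorem IsDiagonalization.le_lambdaMin_gramian (hd : 0 < d) {A : Matrix (Fin d) (Fin d) ℝ}
    {v : Fin d → ℂ} (h : IsDiagonalization A S v) {k : ℕ} (hk : 0 < k) :
    1 + (condNumber S ^ 2)⁻¹ * ∑ s ∈ Finset.Ico 1 k, minEigModulus A ^ (2 * s) ≤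
      lambdaMin (gramian A k) := by
  refine le_lambdaMin_of_quadForm hd (posDef_gramian A hk).isHermitian fun x => ?_
  obtain ⟨y, hy0, hyx, hy⟩ := h.exists_norm_act_bounds hd x
  have ha := lambdaMin_conjTranspose_mul_self_pos hd h.1
  have hab := lambdaMin_le_lambdaMax hd (isHermitian_conjTranspose_mul_self S)
  rw [condNumber_sq hd h.1, inv_div]
  set a := lambdaMin (S.conjTranspose * S)
  set b := lambdaMax (S.conjTranspose * S)
  have hb : 0 < b := ha.trans_le hab
  have hterm : ∀ s, a / b * minEigModulus A ^ (2 * s) * ‖x‖ ^ 2 ≤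
      ‖act (A ^ s).transpose x‖ ^ 2 := by
    intro s
    have hρ := minEigModulus_nonneg A
    have h1 : minEigModulus A ^ (2 * s) * ∑ i, y i ≤ ∑ i, ‖v i‖ ^ (2 * s) * y i := by
      rw [Finset.mul_sum]
      exact Finset.sum_le_sum fun i _ => mul_le_mul_of_nonneg_right
        (pow_le_pow_left₀ hρ (minEigModulus_le h i) _) (hy0 i)
    have h2 : minEigModulus A ^ (2 * s) * (a * ‖x‖ ^ 2) ≤ minEigModulus A ^ (2 * s) * ∑ i, y i :=
      mul_le_mul_of_nonneg_left hyx (by positivity)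
    rw [div_mul_eq_mul_div, div_mul_eq_mul_div, div_le_iff₀ hb]
    linarith [(hy s).1]
  -- The term `s = 0` is the identity and is kept exactly; only the later terms lose the factor
  -- `cond(S)⁻²`.
  rw [quadForm_gramian, Finset.range_eq_Ico, Finset.sum_eq_sum_Ico_succ_bot hk, add_mul, one_mul,
    pow_zero, Matrix.transpose_one, act_one, Finset.mul_sum, Finset.sum_mul]
  gcongr with s
  exact hterm s

end CondNumber

/-! ### Numerical consequences -/

section Numerics

variable {d : ℕ} {S : Matrix (Fin d) (Fin d) ℂ} {A : Matrix (Fin d) (Fin d) ℝ} {v : Fin d → ℂ}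
  {δ : ℝ}

/-- The argument is at least `2` and `log 2 > 1/2`. This lets a constant `K ≥ 0` be absorbed as `K ≤
2Kℓ`. -/
theorem half_lt_log_diag (hd : 0 < d) (hS : IsUnit S.det) (hδ : 0 < δ) (hδ2 : δ < 1 / 2) :
    1 / 2 < Real.log (d * condNumber S / δ) := by
  have hd' : (1 : ℝ) ≤ d := by exact_mod_cast hd
  have hκ := one_le_condNumber hd hS
  have h2 : (2 : ℝ) ≤ d * condNumber S / δ := by
    rw [le_div_iff₀ hδ]
    nlinarith
  have := Real.log_le_log (by norm_num) h2
  linarith [Real.log_two_gt_d9]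

theorem half_le_diagComplexity (hd : 0 < d) (hS : IsUnit S.det) (hδ : 0 < δ) (hδ2 : δ < 1 / 2) :
    1 / 2 ≤ diagComplexity S δ := by
  have hd' : (1 : ℝ) ≤ d := by exact_mod_cast hd
  have := half_lt_log_diag hd hS hδ hδ2
  unfold diagComplexity
  nlinarith

theorem IsDiagonalization.complexity_le (hd : 0 < d) (h : IsDiagonalization A S v)
    (hA : spectralRadius ℂ (toComplex A) ≤ 1) (hδ : 0 < δ) (hδ2 : δ < 1 / 2) {T k : ℕ}
    (hk : 0 < k) (hkT : k ≤ T) :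
    complexity A δ T k ≤ 2 * diagComplexity S δ + d * Real.log (2 * (T / k : ℝ)) := by
  have hd' : (1 : ℝ) ≤ d := by exact_mod_cast hd
  have hκ := one_le_condNumber hd h.1
  have hlog := h.log_det_gramian_le hd hA hk hkT
  have hdδ : 0 ≤ Real.log (d / δ) :=
    (Real.log_nonneg one_le_two).trans (log_two_le_log_div hd hδ hδ2)
  have hsplit : Real.log (d * condNumber S / δ) = Real.log (d / δ) + Real.log (condNumber S) := by
    rw [mul_div_right_comm, Real.log_mul (by positivity) (by positivity)]
  rw [complexity, diagComplexity, hsplit]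
  nlinarith [mul_nonneg (zero_le_one.trans hd') hdδ]

theorem log_dimension_le (hd : 0 < d) (hS : IsUnit S.det) (hδ : 0 < δ) (hδ2 : δ < 1 / 2) :
    Real.log d ≤ Real.log (d * condNumber S / δ) := by
  have hd' : (1 : ℝ) ≤ d := by exact_mod_cast hd
  have hκ := one_le_condNumber hd hS
  refine Real.log_le_log (by positivity) ?_
  rw [le_div_iff₀ hδ]
  nlinarith

/-- Long enough trajectories dominate the complexity term. -/
theorem IsDiagonalization.mul_complexity_le (hd : 0 < d) (h : IsDiagonalization A S v)
    (hA : spectralRadius ℂ (toComplex A) ≤ 1) (hδ : 0 < δ) (hδ2 : δ < 1 / 2) {T k : ℕ}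
    (hk : 0 < k) (hkT : k ≤ T) {a : ℝ} (ha : 1 ≤ a)
    (hT : 2 * a * (3 + 2 * Real.log (4 * a)) * diagComplexity S δ ≤ (T : ℝ) / k) :
    a * complexity A δ T k ≤ (T : ℝ) / k := by
  have hd' : (1 : ℝ) ≤ d := by exact_mod_cast hd
  have hX : 1 ≤ (T : ℝ) / k :=
    (one_le_div (by positivity)).2 (by exact_mod_cast hkT)
  have hcomp := h.complexity_le hd hA hδ hδ2 hk hkT
  have hlogd := log_dimension_le hd h.1 hδ hδ2
  have hℓ := half_lt_log_diag hd h.1 hδ hδ2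
  set X : ℝ := (T : ℝ) / k with hX_def
  set ℓ := Real.log (d * condNumber S / δ) with hℓ_def
  have hL : diagComplexity S δ = d * ℓ := rfl
  rw [hL] at hcomp hT
  have hK : 0 ≤ Real.log (4 * a) := Real.log_nonneg (by linarith)
  -- The scale `4ad` is chosen so that `log z ≤ z` costs only `X/(2a)` after multiplication by `d`;
  -- after the further factor `a` this is half of `X`.
  have hsplit : Real.log (2 * X) =
      Real.log (2 * X / (d * (4 * a))) + (Real.log d + Real.log (4 * a)) := by
    rw [← Real.log_mul (by positivity) (by positivity),
      ← Real.log_mul (by positivity) (by positivity)]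
    congr 1
    field_simp
  have h1 : Real.log (2 * X / (d * (4 * a))) ≤ 2 * X / (d * (4 * a)) :=
    Real.log_le_self (by positivity)
  have h2 : Real.log (2 * X) ≤ 2 * X / (d * (4 * a)) + ℓ + 2 * Real.log (4 * a) * ℓ := by
    rw [hsplit]
    nlinarith
  have h3 : d * Real.log (2 * X) ≤ X / (2 * a) + (1 + 2 * Real.log (4 * a)) * (d * ℓ) := by
    calc d * Real.log (2 * X)
        ≤ d * (2 * X / (d * (4 * a)) + ℓ + 2 * Real.log (4 * a) * ℓ) :=
          mul_le_mul_of_nonneg_left h2 (by positivity)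
      _ = _ := by field_simp; ring
  have h4 : complexity A δ T k ≤ X / (2 * a) + (3 + 2 * Real.log (4 * a)) * (d * ℓ) := by
    linarith
  calc a * complexity A δ T k
      ≤ a * (X / (2 * a) + (3 + 2 * Real.log (4 * a)) * (d * ℓ)) :=
        mul_le_mul_of_nonneg_left h4 (by positivity)
    _ = X / 2 + 2 * a * (3 + 2 * Real.log (4 * a)) * (d * ℓ) / 2 := by field_simp
    _ ≤ X := by linarith

/-- For the largest admissible block length, the complexity is of the order of
`diagComplexity`. -/
theorem IsDiagonalization.complexity_le_mul (hd : 0 < d) (h : IsDiagonalization A S v)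
    (hA : spectralRadius ℂ (toComplex A) ≤ 1) (hδ : 0 < δ) (hδ2 : δ < 1 / 2) {T k : ℕ}
    (hk : 0 < k) (hkT : k ≤ T) {c : ℝ} (hc : 1 ≤ c)
    (hT : (T : ℝ) / k ≤ 2 * (c * diagComplexity S δ)) :
    complexity A δ T k ≤ (4 + 2 * Real.log (4 * c)) * diagComplexity S δ := by
  have hd' : (1 : ℝ) ≤ d := by exact_mod_cast hd
  have hX : 1 ≤ (T : ℝ) / k :=
    (one_le_div (by positivity)).2 (by exact_mod_cast hkT)
  have hcomp := h.complexity_le hd hA hδ hδ2 hk hkT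
  have hlogd := log_dimension_le hd h.1 hδ hδ2
  have hℓ := half_lt_log_diag hd h.1 hδ hδ2
  set X : ℝ := (T : ℝ) / k with hX_def
  set ℓ := Real.log (d * condNumber S / δ) with hℓ_def
  have hL : diagComplexity S δ = d * ℓ := rfl
  rw [hL] at hcomp hT ⊢
  have hℓ0 : 0 < ℓ := by linarith
  have hK : 0 ≤ Real.log (4 * c) := Real.log_nonneg (by linarith)
  -- Now `X` is at most `2cdℓ`, so its logarithm is of order `ℓ`: both `log d` and `log ℓ` are at
  -- most `ℓ`.
  have h1 : Real.log (2 * X) ≤ Real.log (4 * c) + (Real.log d + Real.log ℓ) := by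
    rw [← Real.log_mul (by positivity) hℓ0.ne', ← Real.log_mul (by positivity) (by positivity)]
    exact Real.log_le_log (by positivity) (by linarith)
  have h2 : Real.log ℓ ≤ ℓ := Real.log_le_self hℓ0.le
  have h3 : Real.log (2 * X) ≤ (2 + 2 * Real.log (4 * c)) * ℓ := by nlinarith
  nlinarith [mul_le_mul_of_nonneg_left h3 (zero_le_one.trans hd')]

end Numerics

end LDS

/-! ### Choice of constants and conclusion -/

theorem mainTheorem9 :
    ∀ c₀ : ℝ, 0 < c₀ → ∃ c C : ℝ, 0 < c ∧ 0 < C ∧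
      ∀ (d T : ℕ) (δ : ℝ) (A : Matrix (Fin d) (Fin d) ℝ)
        (S : Matrix (Fin d) (Fin d) ℂ) (v : Fin d → ℂ),
        0 < d → 0 < δ → δ < 1 / 2 →
        LDS.IsDiagonalization A S v →
        spectralRadius ℂ (LDS.toComplex A) ≤ 1 →
        -- every such `k` satisfies the block-length condition
        (∀ k : ℕ, 0 < k → c * LDS.diagComplexity S δ ≤ (T : ℝ) / k →
          c₀ * LDS.complexity A δ T k ≤ (T : ℝ) / k) ∧
        ∀ {Ω : Type*} [MeasurableSpace Ω] (μ : Measure Ω) [IsProbabilityMeasure μ]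
          (σ : ℝ) (η : ℕ → Ω → EuclideanSpace ℝ (Fin d))
          (Ahat : Ω → Matrix (Fin d) (Fin d) ℝ),
          0 < σ → LDS.IsGaussianNoise μ σ η →
          (∀ ω, LDS.IsOLS (LDS.state A (fun t => η t ω)) T (Ahat ω)) →
          -- and the least-squares guarantee with block length `k` holds
          (∀ k : ℕ, 0 < k → c * LDS.diagComplexity S δ ≤ (T : ℝ) / k →
            μ {ω | C / Real.sqrt (T * LDS.lambdaMin (LDS.gramian A k)) *
                  Real.sqrt (LDS.complexity A δ T k) < LDS.opNorm (Ahat ω - A)}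
              ≤ ENNReal.ofReal δ) ∧
          -- the explicit bounds for the largest such block length
          (c * LDS.diagComplexity S δ ≤ T →
            ∀ K : ℕ, K = ⌊(T : ℝ) / (c * LDS.diagComplexity S δ)⌋₊ →
            ∀ ε₁ ε₂ : ℝ,
            ε₁ = C * Real.sqrt (LDS.diagComplexity S δ /
                  (T * LDS.lambdaMin (LDS.gramian A K))) →
            ε₂ = C * Real.sqrt (LDS.diagComplexity S δ /
                  (T * (1 + (LDS.condNumber S ^ 2)⁻¹ *
                    ∑ s ∈ Finset.Ico 1 K, LDS.minEigModulus A ^ (2 * s)))) →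
            μ {ω | ε₁ < LDS.opNorm (Ahat ω - A)} ≤ ENNReal.ofReal δ ∧
            ε₁ ≤ ε₂ ∧
            μ {ω | ε₂ < LDS.opNorm (Ahat ω - A)} ≤ ENNReal.ofReal δ) := by
  intro c₀ hc₀
  -- `c₀` serves the admissibility claim and `80` the probabilistic guarantee. Then `c` is the
  -- threshold of `mul_complexity_le`, and `b` the factor of `complexity_le_mul`.
  set a : ℝ := max c₀ 80 with ha_def
  have ha : 80 ≤ a := le_max_right _ _
  have hac : c₀ ≤ a := le_max_left _ _
  have hlog4a : 0 ≤ Real.log (4 * a) := Real.log_nonneg (by linarith)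
  set c : ℝ := 2 * a * (3 + 2 * Real.log (4 * a)) with hc_def
  have hc : 480 ≤ c := by nlinarith
  have hlog4c : 0 ≤ Real.log (4 * c) := Real.log_nonneg (by linarith)
  set b : ℝ := 4 + 2 * Real.log (4 * c) with hb_def
  have hb : 1 ≤ b := by linarith
  refine ⟨c, 1120 * b, by linarith, by positivity, ?_⟩
  intro d T δ A S v hd hδ hδ2 hdiag hρ
  have hL := LDS.half_le_diagComplexity hd hdiag.1 hδ hδ2
  have hcL : 240 ≤ c * LDS.diagComplexity S δ := by nlinarith
  have hblock : ∀ k : ℕ, 0 < k → c * LDS.diagComplexity S δ ≤ (T : ℝ) / k →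
      2 * k ≤ T ∧ a * LDS.complexity A δ T k ≤ (T : ℝ) / k := by
    intro k hk hkT
    have hk' : (0 : ℝ) < k := by positivity
    have h2k : 2 * k ≤ T := by
      have h1 : (2 : ℝ) ≤ T / k := by linarith
      rw [le_div_iff₀ hk'] at h1
      exact_mod_cast h1
    exact ⟨h2k, hdiag.mul_complexity_le hd hρ hδ hδ2 hk (by omega) (by linarith) hkT⟩
  refine ⟨fun k hk hkT => ?_, ?_⟩
  · obtain ⟨h2k, h⟩ := hblock k hk hkT
    exact (mul_le_mul_of_nonneg_right hac
      (LDS.complexity_pos A hd hδ hδ2 hk (by omega)).le).trans h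
  intro Ω _ μ _ σ η Ahat hσ hη hA
  have hmain : ∀ k : ℕ, 0 < k → c * LDS.diagComplexity S δ ≤ (T : ℝ) / k →
      ∀ C' : ℝ, 1120 ≤ C' → μ {ω | C' / √(T * LDS.lambdaMin (LDS.gramian A k)) *
        √(LDS.complexity A δ T k) < LDS.opNorm (Ahat ω - A)} ≤ ENNReal.ofReal δ := by
    intro k hk hkT C' hC'
    obtain ⟨h2k, h⟩ := hblock k hk hkT
    have hpos := LDS.complexity_pos A hd hδ hδ2 hk (show k ≤ T by omega)
    exact hη.measure_opNorm_sub_le hσ hd hk hδ hδ2 h2k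
      ((mul_le_mul_of_nonneg_right ha hpos.le).trans h) hA hC'
  refine ⟨fun k hk hkT => hmain k hk hkT _ (by linarith), ?_⟩
  rintro hT K hK ε₁ ε₂ rfl rfl
  have hcL0 : 0 < c * LDS.diagComplexity S δ := by linarith
  have hT0 : (0 : ℝ) < T := hcL0.trans_le hT
  have hy1 : 1 ≤ (T : ℝ) / (c * LDS.diagComplexity S δ) := (one_le_div hcL0).2 hT
  have hK0 : 0 < K := by rw [hK]; exact Nat.floor_pos.2 hy1
  have hK1 : (1 : ℝ) ≤ K := by exact_mod_cast hK0
  have hKle : (K : ℝ) ≤ T / (c * LDS.diagComplexity S δ) := by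
    rw [hK]; exact Nat.floor_le (by positivity)
  have hKlt : (T : ℝ) / (c * LDS.diagComplexity S δ) < K + 1 := by
    rw [hK]; exact Nat.lt_floor_add_one _
  have hKT : c * LDS.diagComplexity S δ ≤ (T : ℝ) / K := by
    rw [le_div_iff₀ hcL0] at hKle
    rw [le_div_iff₀ (by positivity)]
    linarith
  -- As `K ≥ 1`, `T/(cL) < K + 1 ≤ 2K`: the largest block length makes `T/K` comparable to `cL`.
  have hTK : (T : ℝ) / K ≤ 2 * (c * LDS.diagComplexity S δ) := by
    rw [div_lt_iff₀ hcL0] at hKlt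
    rw [div_le_iff₀ (by positivity)]
    nlinarith
  have h2K := (hblock K hK0 hKT).1
  have hcomp := hdiag.complexity_le_mul hd hρ hδ hδ2 hK0 (show K ≤ T by omega)
    (by linarith) hTK
  have hlam := LDS.one_le_lambdaMin_gramian hd A hK0
  have hε₁ : μ {ω | 1120 * b * √(LDS.diagComplexity S δ /
      (T * LDS.lambdaMin (LDS.gramian A K))) < LDS.opNorm (Ahat ω - A)} ≤ ENNReal.ofReal δ := by
    refine le_trans (measure_mono fun ω hω => ?_) (hmain K hK0 hKT 1120 le_rfl)
    rw [Set.mem_ofPred_eq] at hω ⊢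
    refine lt_of_le_of_lt ?_ hω
    rw [Real.sqrt_div (by linarith), div_mul_eq_mul_div, mul_div_assoc', mul_assoc]
    -- Here `b` rather than `√b` suffices, since `b ≥ 1`.
    have hsq : √(LDS.complexity A δ T K) ≤ b * √(LDS.diagComplexity S δ) := by
      refine Real.sqrt_le_iff.2 ⟨by positivity, ?_⟩
      rw [mul_pow, Real.sq_sqrt (by linarith)]
      refine hcomp.trans (mul_le_mul_of_nonneg_right ?_ (by linarith))
      nlinarith
    gcongr
  have hle : 1120 * b * √(LDS.diagComplexity S δ / (T * LDS.lambdaMin (LDS.gramian A K))) ≤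
      1120 * b * √(LDS.diagComplexity S δ / (T * (1 + (LDS.condNumber S ^ 2)⁻¹ *
        ∑ s ∈ Finset.Ico 1 K, LDS.minEigModulus A ^ (2 * s)))) := by
    have hmin := LDS.minEigModulus_nonneg A
    have hden : 0 < 1 + (LDS.condNumber S ^ 2)⁻¹ *
        ∑ s ∈ Finset.Ico 1 K, LDS.minEigModulus A ^ (2 * s) := by positivity
    have := hdiag.le_lambdaMin_gramian hd hK0
    gcongr
  exact ⟨hε₁, hle, le_trans (measure_mono fun ω hω => hle.trans_lt hω) hε₁⟩
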